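/- **Setting.** Let $M$ be a compact connected Riemannian manifold of finite dimension $d$, with Riemannian distance and its Borel $\sigma$-algebra, and let $\mathrm{Leb}$ be a normalised volume on $M$ (a probability measure which in charts has a continuous positive density). Let $f:M\to M$ be continuous on a set $Y$ of full $\mathrm{Leb}$-measure, and suppose there is $x_0\in M$ such that $\{f^nx_0:n\ge 0\}$ is dense in $M$ and contained in $Y$. Let $\mu$ be a Borel probability measure on $M$. Suppose that one of the following holds. (a) *Random maps.* $X$ is a compact metric space, $\theta$ is a Borel probability measure on $X$, $\omega^*\in X$, $\operatorname{supp}\theta$ contains a ball of positive radius around $\omega^*$, and $F:M\times X\to M$ is measurable. Write $f_\omega(x)=f^x(\omega)=F(x,\omega)$. Assume $f_{\omega^*}=f$, and that there are constants $\rho_0>0$ and $\overline q>\underline q>0$ such that for $\mathrm{Leb}$-a.e. $x$: $\operatorname{supp}\big((f^x)_*\theta\big)\supset B_{\rho_0}(f(x))$, and $(f^x)_*\theta=q_x\,\mathrm{Leb}$ with $\underline q\le q_x\le\overline q$ $\mathrm{Leb}$-a.e. on $\operatorname{supp}\big((f^x)_*\theta\big)$. Assume also that $(f^x)_*\theta\ll\mathrm{Leb}$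 for $\mu$-a.e. $x$, and that $\mu$ is stationary: $\iint g\circ f_\omega\,d\mu\,d\theta(\omega)=\int g\,d\mu$ for every $\mu$-integrable $g:M\to\mathbb R$. Put $Z_0(x,\underline\omega)=x$ and $Z_n(x,\underline\omega)=f_{\omega_n}\circ\cdots\circ f_{\omega_1}(x)$ on the probability space $(M\times X^{\mathbb N},\ \mathbb P=\mu\times\theta^{\mathbb N})$. (b) *Markov chain.* $(p_x)_{x\in M}$ is a family of transition probabilities $p_x=q_x\,\mathrm{Leb}$, where each $q_x$ is a positive probability density, Hölder continuous for some exponent $\alpha>0$, $x\mapsto q_x$ is continuous in the $C^0$-topology, and there are $\rho_0>0$, $\overline q>\underline q>0$ with $\operatorname{supp}q_x\supset B_{\rho_0}(f(x))$ and $\underline q\le q_x\le\overline q$ for all $x\in Y$. The measure $\mu$ is stationary, $\int p_x(A)\,d\mu(x)=\mu(A)$ for all Borel $A$, and $Z_0,Z_1,\dots$ is a Markov chain with transition probabilities $(p_x)$ and initial law $\mu$ on a probability space with probability $\mathbb P$. Let $\zeta\in M$ and let $\varphi:M\to\mathbb R\cup\{\pm\infty\}$ be measurable with a global maximum at $\zeta$,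 such that for $u<\varphi(\zeta)$ sufficiently close to $\varphi(\zeta)$ the set $\{\varphi>u\}$ is a topological ball centred at $\zeta$ (the image of the open unit ball of $\mathbb R^d$ under a homeomorphism taking $0$ to $\zeta$), and such that $u\mapsto\mu\{\varphi>u\}$ is continuous in a neighbourhood of $\varphi(\zeta)$. Put $X_n=\varphi(Z_n)$, and let $(u_n)$ be a sequence of real numbers with $n\,\mathbb P(X_0>u_n)\to\tau$ for some $\tau>0$. Let $\mathcal R$ be the ring of finite unions of intervals $[a,b)$ with $a,b\in[0,\infty)$. For $A\subset\mathbb R$ put $\mathscr N_u(A)=\sum_{i\in A\cap\mathbb N_0}\mathbf 1_{\{X_i>u\}}$, and let $N_n(J)=\mathscr N_{u_n}(v_nJ)$ with $v_n=1/\mathbb P(X_0>u_n)$ for $J\in\mathcal R$ (the rare event point process). **Conclusion.** 1. $D_3(u_n)$ holds: there are a function $\gamma(n,t)$, nonincreasing in $t$ for each $n$, and integers $t_n\ge0$ with $t_n=o(n)$ and $n\gamma(n,t_n)\to0$, such that for all $A\in\mathcal R$ and all $n,t\in\mathbb N_0$, $$\big|\mathbb P\big(X_0>u_n,\ \mathscr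 N_{u_n}(A+t)=0\big)-\mathbb P(X_0>u_n)\,\mathbb P\big(\mathscr N_{u_n}(A)=0\big)\big|\le\gamma(n,t).$$ 2. $D'(u_n)$ holds: for every sequence $(t_n)$ as in 1 there are integers $k_n\to\infty$ with $k_nt_n=o(n)$ and $$\lim_{n\to\infty}n\sum_{j=1}^{\lfloor n/k_n\rfloor}\mathbb P(X_0>u_n,\ X_j>u_n)=0.$$ 3. $N_n$ converges in distribution to a Poisson process $N$ on $[0,\infty)$ of intensity $1$: for all $k$ and $J_1,\dots,J_k\in\mathcal R$, the random vectors $(N_n(J_1),\dots,N_n(J_k))$ converge in distribution to $(N(J_1),\dots,N(J_k))$. -/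

import Mathlib

open MeasureTheory ProbabilityTheory Filter Set
open scoped Topology ENNReal NNReal Manifold Bundle

noncomputable section

namespace RareEvents

/-! ### Lebesgue measure on a manifold -/

/-- `m` is the measure of a (continuous, nowhere vanishing) volume form, i.e. of a positive
density: in every preferred chart it is Lebesgue measure multiplied by a continuous positive
function. The Riemannian volume and all its constant multiples are of this form.
The normalisation `m univ = 1` is imposed separately, by `IsProbabilityMeasure m`. -/
def IsVolumeMeasure {d : ℕ} {M : Type*} [TopologicalSpace M] [MeasurableSpace M]
    [ChartedSpace (EuclideanSpace ℝ (Fin d)) M] (m : Measure M) : Prop :=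
  ∀ p : M, ∃ ρ : EuclideanSpace ℝ (Fin d) → ℝ,
    ContinuousOn ρ (chartAt (EuclideanSpace ℝ (Fin d)) p).target ∧
    (∀ y ∈ (chartAt (EuclideanSpace ℝ (Fin d)) p).target, 0 < ρ y) ∧
    (m.restrict (chartAt (EuclideanSpace ℝ (Fin d)) p).source).map
        (chartAt (EuclideanSpace ℝ (Fin d)) p) =
      (volume.restrict (chartAt (EuclideanSpace ℝ (Fin d)) p).target).withDensity
        (fun y => ENNReal.ofReal (ρ y))

/-! ### The unperturbed map -/

/-- `f` is continuous on a set `Y` of full measure that contains a dense forward orbit. -/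
structure IsTransitiveOn {M : Type*} [TopologicalSpace M] [MeasurableSpace M]
    (Leb : Measure M) (f : M → M) (Y : Set M) (x₀ : M) : Prop where
  full : ∀ᵐ x ∂Leb, x ∈ Y
  cont : ContinuousOn f Y
  orbit_mem : ∀ n : ℕ, f^[n] x₀ ∈ Y
  orbit_dense : Dense (Set.range fun n : ℕ => f^[n] x₀)

/-! ### Random perturbations -/

/-- The family `f_ω = F · ω`, `ω ∈ X`, with noise distribution `θ`, is a uniformly continuous
random perturbation of `f`. Here `f^x = F x : X → M` and `θ.map (F x)` is the law `(f^x)_* θ` of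
the perturbed image of `x`. The perturbed images are required to cover the ball of radius `ρ₀`
around `f x` in the sense that this ball lies in the support of `(f^x)_* θ`; for `f^x` continuous
this support contains `f^x (supp θ)`, see `image_support_subset`. -/
structure IsUniformRandomPerturbation {M X : Type*} [MetricSpace M] [MeasurableSpace M]
    [MetricSpace X] [MeasurableSpace X]
    (Leb : Measure M) (f : M → M) (F : M → X → M) (θ : Measure X) (ωstar : X) : Prop where
  measurable : Measurable (Function.uncurry F)
  support : ∃ ε₀ > 0, Metric.ball ωstar ε₀ ⊆ θ.support
  unperturbed : ∀ x, F x ωstar = f x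
  covers : ∃ ρ₀ > 0, ∀ᵐ x ∂Leb, Metric.ball (f x) ρ₀ ⊆ (θ.map (F x)).support
  density : ∃ qlo qhi : ℝ, 0 < qlo ∧ qlo < qhi ∧ ∀ᵐ x ∂Leb, ∃ q : M → ℝ≥0, Measurable q ∧
    θ.map (F x) = Leb.withDensity (fun y => (q y : ℝ≥0∞)) ∧
    ∀ᵐ y ∂Leb, y ∈ (θ.map (F x)).support → qlo ≤ q y ∧ (q y : ℝ) ≤ qhi

/-- For continuous `g`, the image of the support lies in the support of the image measure. -/
theorem image_support_subset {M X : Type*} [TopologicalSpace M] [MeasurableSpace M] [BorelSpace M]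
    [TopologicalSpace X] [MeasurableSpace X] [BorelSpace X] (θ : Measure X) {g : X → M}
    (hg : Continuous g) : g '' θ.support ⊆ (θ.map g).support := by
  rintro _ ⟨x, hx, rfl⟩
  rw [Measure.mem_support_iff_forall] at hx ⊢
  intro U hU
  exact (hx _ (hg.continuousAt hU)).trans_le (Measure.le_map_apply hg.aemeasurable U)

/-- The random orbit `f^n_ω x = f_{ω_n} ∘ ⋯ ∘ f_{ω_1} x`; the letters `ω_1, ω_2, …` of the
realisation are `ω 0, ω 1, …`. -/
def randomOrbit {M X : Type*} (F : M → X → M) (x : M) (ω : ℕ → X) : ℕ → M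
  | 0 => x
  | n + 1 => F (randomOrbit F x ω n) (ω n)

/-- `μ` is stationary for the random maps `f_ω`: `∬ g ∘ f_ω dμ dθ(ω) = ∫ g dμ`. -/
def IsStationary {M X : Type*} [MeasurableSpace M] [MeasurableSpace X]
    (F : M → X → M) (θ : Measure X) (μ : Measure M) : Prop :=
  ∀ g : M → ℝ, Integrable g μ → ∫ ω, (∫ x, g (F x ω) ∂μ) ∂θ = ∫ x, g x ∂μ

/-- The noise space `X^ℕ` carries the product measure `θ^ℕ`, and `M × X^ℕ` carries `μ × θ^ℕ`. -/
def annealedMeasure {M X : Type*} [MeasurableSpace M] [MeasurableSpace X]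
    (μ : Measure M) (θ : Measure X) : Measure (M × (ℕ → X)) :=
  μ.prod (Measure.infinitePi fun _ : ℕ => θ)

instance {M X : Type*} [MeasurableSpace M] [MeasurableSpace X]
    (μ : Measure M) (θ : Measure X) [IsProbabilityMeasure μ] [IsProbabilityMeasure θ] :
    IsProbabilityMeasure (annealedMeasure μ θ) := by
  unfold annealedMeasure; infer_instance

/-! ### Markov chains -/

/-- The transition probabilities `p_x = q_x Leb` have positive, Hölder continuous densities `q_x`
varying continuously with `x` in the uniform topology, with `supp q_x ⊇ B(f x, ρ₀)` and
`qlo ≤ q_x ≤ qhi` for `x ∈ Y`. -/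
structure IsMarkovPerturbation {M : Type*} [MetricSpace M] [MeasurableSpace M]
    (Leb : Measure M) (f : M → M) (Y : Set M) (p : Kernel M M) : Prop where
  density : ∃ q : C(M, C(M, ℝ)),
    (∀ x y, 0 < q x y) ∧
    (∀ x, p x = Leb.withDensity (fun y => ENNReal.ofReal (q x y))) ∧
    (∃ α : ℝ≥0, 0 < α ∧ ∀ x, ∃ C : ℝ≥0, HolderWith C α (q x)) ∧
    (∃ ρ₀ > 0, ∀ x ∈ Y, Metric.ball (f x) ρ₀ ⊆ tsupport (q x)) ∧
    ∃ qlo qhi : ℝ, 0 < qlo ∧ qlo < qhi ∧ ∀ x ∈ Y, ∀ y, qlo ≤ q x y ∧ q x y ≤ qhi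

/-- `Z₀, Z₁, …` is a Markov chain on `(Ω, P)` with transition probabilities `p` and initial
distribution `μ`. -/
structure IsMarkovChain {M Ω : Type*} [MeasurableSpace M] [MeasurableSpace Ω]
    (P : Measure Ω) (p : Kernel M M) (μ : Measure M) (Z : ℕ → Ω → M) : Prop where
  measurable : ∀ n, Measurable (Z n)
  initial : P.map (Z 0) = μ
  transition : ∀ (n : ℕ) (B : Set (Fin (n + 1) → M)) (A : Set M),
    MeasurableSet B → MeasurableSet A →
    P {ω | (fun i : Fin (n + 1) => Z i ω) ∈ B ∧ Z (n + 1) ω ∈ A} =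
      ∫⁻ ω in {ω | (fun i : Fin (n + 1) => Z i ω) ∈ B}, p (Z n ω) A ∂P

/-! ### The observable -/

/-- `φ` is measurable and has a global maximum at `ζ`; the superlevel sets `{φ > u}` are, for
`u < φ ζ` close to `φ ζ`, topological balls centred at `ζ`; and `μ {φ > u}` depends continuously
on `u` in a neighbourhood of `φ ζ`. -/
structure IsRegularObservable (d : ℕ) {M : Type*} [TopologicalSpace M] [MeasurableSpace M]
    (μ : Measure M) (φ : M → EReal) (ζ : M) : Prop where
  measurable : Measurable φ
  max : ∀ x, φ x ≤ φ ζ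
  ball : ∀ᶠ u in 𝓝[<] (φ ζ),
    ∃ h : Metric.ball (0 : EuclideanSpace ℝ (Fin d)) 1 ≃ₜ {x : M | u < φ x},
      (h ⟨0, Metric.mem_ball_self one_pos⟩ : M) = ζ
  cont : ∃ V ∈ 𝓝 (φ ζ), ContinuousOn (fun u : EReal => μ {x | u < φ x}) V

/-! ### Exceedances and the conditions on the process -/

/-- The ring generated by the intervals `[a, b)`, `a, b ∈ [0, ∞)`: finite unions of them. -/
def InRing (A : Set ℝ) : Prop :=
  ∃ s : Finset (ℝ × ℝ), (∀ I ∈ s, 0 ≤ I.1 ∧ 0 ≤ I.2) ∧ A = ⋃ I ∈ s, Set.Ico I.1 I.2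

/-- The number `∑_{i ∈ A ∩ ℕ₀} 1_{X_i > u}` of exceedances of the level `u` at times in `A`. -/
def exceedances {Ω : Type*} (X : ℕ → Ω → EReal) (u : ℝ) (A : Set ℝ) (ω : Ω) : ℝ≥0∞ :=
  ∑' i : ℕ, Set.indicator {i : ℕ | (i : ℝ) ∈ A ∧ (u : EReal) < X i ω} 1 i

/-- The rare event point process `N_n(J)`: the number of exceedances of `u_n` during `v_n J`, with
`v_n = 1 / P(X₀ > u_n)`. -/
def repp {Ω : Type*} [MeasurableSpace Ω] (P : Measure Ω) (X : ℕ → Ω → EReal) (u : ℕ → ℝ)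
    (n : ℕ) (J : Set ℝ) (ω : Ω) : ℝ≥0∞ :=
  exceedances X (u n) ((fun s => (P.real {ω | (u n : EReal) < X 0 ω})⁻¹ * s) '' J) ω

/-- Condition `D₃(u_n)`, with `t` in the role of the sequence `t_n = o(n)`. -/
def CondD3 {Ω : Type*} [MeasurableSpace Ω] (P : Measure Ω) (X : ℕ → Ω → EReal) (u : ℕ → ℝ)
    (t : ℕ → ℕ) : Prop :=
  Tendsto (fun n : ℕ => (t n : ℝ) / n) atTop (𝓝 0) ∧
  ∃ γ : ℕ → ℕ → ℝ,
    (∀ A : Set ℝ, InRing A → ∀ n s : ℕ,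
      |P.real {ω | (u n : EReal) < X 0 ω ∧
          exceedances X (u n) ((fun r => r + (s : ℝ)) '' A) ω = 0}
        - P.real {ω | (u n : EReal) < X 0 ω} * P.real {ω | exceedances X (u n) A ω = 0}|
        ≤ γ n s) ∧
    (∀ n, Antitone (γ n)) ∧
    Tendsto (fun n : ℕ => (n : ℝ) * γ n (t n)) atTop (𝓝 0)

/-- Condition `D'(u_n)`, relative to the sequence `t_n`: there are integers `k_n → ∞` with
`k_n t_n = o(n)` and `n ∑_{j=1}^{⌊n/k_n⌋} P(X₀ > u_n, X_j > u_n) → 0`. -/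
def CondD' {Ω : Type*} [MeasurableSpace Ω] (P : Measure Ω) (X : ℕ → Ω → EReal) (u : ℕ → ℝ)
    (t : ℕ → ℕ) : Prop :=
  ∃ k : ℕ → ℕ, Tendsto k atTop atTop ∧
    Tendsto (fun n : ℕ => (k n : ℝ) * t n / n) atTop (𝓝 0) ∧
    Tendsto (fun n : ℕ => (n : ℝ) * ∑ j ∈ Finset.Icc 1 (n / k n),
      P.real {ω | (u n : EReal) < X 0 ω ∧ (u n : EReal) < X j ω}) atTop (𝓝 0)

/-! ### The Poisson process -/

/-- `N` is a Poisson process of intensity `1` on `[0, ∞)`: a random measure that gives every Borel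
set `B ⊆ [0, ∞)` of finite length a Poisson distributed mass with mean the length of `B`, and gives
disjoint sets independent masses. -/
structure IsPoissonProcess {Ω : Type*} [MeasurableSpace Ω] (Q : Measure Ω)
    (N : Ω → Measure ℝ) : Prop where
  measurable : Measurable N
  law : ∀ B : Set ℝ, MeasurableSet B → B ⊆ Set.Ici 0 → volume B ≠ ∞ →
    Q.map (fun ω => N ω B) =
      (poissonMeasure (volume B).toNNReal).map (fun n : ℕ => (n : ℝ≥0∞))
  indep : ∀ (k : ℕ) (B : Fin k → Set ℝ), (∀ i, MeasurableSet (B i)) → (∀ i, B i ⊆ Set.Ici 0) →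
    Pairwise (fun i j => Disjoint (B i) (B j)) → iIndepFun (fun i ω => N ω (B i)) Q

/-- Convergence in distribution of the point processes `N_n` to `N`: for all `J₁, …, J_k` in the
ring, the random vectors `(N_n(J₁), …, N_n(J_k))` converge in distribution to
`(N(J₁), …, N(J_k))`. -/
def ConvergesInDistribution {Ω Ω' : Type*} [MeasurableSpace Ω] [MeasurableSpace Ω']
    (P : Measure Ω) [IsProbabilityMeasure P] (Nn : ℕ → Set ℝ → Ω → ℝ≥0∞)
    (Q : Measure Ω') [IsProbabilityMeasure Q] (N : Ω' → Measure ℝ) : Prop :=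
  ∀ (k : ℕ) (J : Fin k → Set ℝ), (∀ i, InRing (J i)) →
    TendstoInDistribution (fun (n : ℕ) (ω : Ω) (i : Fin k) => Nn n (J i) ω) atTop
      (fun (ω : Ω') (i : Fin k) => N ω (J i)) (fun _ => P) Q

/-- The process `X` satisfies `D₃(u_n)` and `D'(u_n)` (the latter relative to every sequence
`t_n = o(n)` that is admissible in `D₃(u_n)`), and its rare event point processes converge in
distribution to the Poisson process of intensity `1`. -/
def HasPoissonRareEvents.{v, w} {Ω : Type w} [MeasurableSpace Ω] (P : Measure Ω)
    [IsProbabilityMeasure P] (X : ℕ → Ω → EReal) (u : ℕ → ℝ) : Prop :=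
  (∃ t : ℕ → ℕ, CondD3 P X u t) ∧
  (∀ t : ℕ → ℕ, CondD3 P X u t → CondD' P X u t) ∧
  ∀ (Ω' : Type v) [MeasurableSpace Ω'] (Q : Measure Ω') [IsProbabilityMeasure Q]
    (N : Ω' → Measure ℝ), IsPoissonProcess Q N →
    ConvergesInDistribution P (repp P X u) Q N

end RareEvents

end

open RareEvents
universe a b c v

/-! Both settings reduce to a stationary Markov chain satisfying two bounds relative to `μ`: one
step has density at most `C` (`HasDensityBound`), and `N` steps dominate `c • μ` (`Doeblin`). All of
extreme value theory is done for such chains (`IsMixingChain`).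

Doeblin's condition makes the Markov operator contract mean-zero functions by the factor `1 - c`
every `N` steps. The future after a gap is therefore almost independent of the past, with an error
proportional to the mass of the past event; this is `D₃` with an exponential `γ`. The density bound
gives two visits to `U` at distinct times a probability of at most `C * μ(U)²`, however short the
gap (`integral_pair_le`); this excludes clusters and gives `D'`.

The Poisson limit uses the same two estimates directly, through Laplace transforms. The transform of
`N_n` is the expectation of a product of factors `1 - w i * 1_U(Z i)`. With `δ = μ(U)`, one more
factor multiplies this expectation by `1 - w m * δ` up to `o(δ)` (`abs_integral_visitProd_succ`).
Over `O(1/δ)` times the errors vanish, and a Riemann sum turns the product into the Laplace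
transform of the Poisson process. Stone–Weierstrass on the compact space `[0, ∞]^k` gives
convergence in distribution.

For the Markov chain, a density bounded below gives Doeblin's condition with `N = 1`. Random maps
spread mass over a ball around `f x`, so the chain can follow pseudo-orbits of `f` along the dense
orbit. Connectedness of `M` excludes a common period of the closed pseudo-orbits (`setGcd_reach`),
so one length joins all pairs of balls in a finite cover (`exists_forall_reach`). This gives the
lower bound relative to volume (`exists_lower_bound`), which is then transferred to `μ`. -/

namespace RareEvents

set_option linter.unusedSectionVars false

/-! ### Bounded measurable functions and averaging along a kernel -/

/-- `g` is measurable and bounded. -/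
def BddMeas {α : Type*} [MeasurableSpace α] (g : α → ℝ) : Prop :=
  Measurable g ∧ ∃ K, ∀ x, |g x| ≤ K

namespace BddMeas

variable {α β : Type*} [MeasurableSpace α] [MeasurableSpace β] {g h : α → ℝ}

theorem of_le {K : ℝ} (hg : Measurable g) (hK : ∀ x, |g x| ≤ K) : BddMeas g := ⟨hg, K, hK⟩

theorem integrable (hg : BddMeas g) (ν : Measure α) [IsFiniteMeasure ν] : Integrable g ν := by
  obtain ⟨hm, K, hK⟩ := hg
  exact Integrable.of_bound hm.aestronglyMeasurable K (ae_of_all _ hK)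

theorem const (a : ℝ) : BddMeas fun _ : α => a := of_le measurable_const fun _ => le_rfl

theorem add (hg : BddMeas g) (hh : BddMeas h) : BddMeas fun x => g x + h x := by
  obtain ⟨hg, K, hK⟩ := hg
  obtain ⟨hh, L, hL⟩ := hh
  exact of_le (hg.add hh) fun x => (abs_add_le _ _).trans (add_le_add (hK x) (hL x))

theorem neg (hg : BddMeas g) : BddMeas fun x => -g x :=
  ⟨hg.1.neg, by simpa only [abs_neg] using hg.2⟩

theorem sub (hg : BddMeas g) (hh : BddMeas h) : BddMeas fun x => g x - h x := by
  simpa only [sub_eq_add_neg] using hg.add hh.neg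

theorem mul (hg : BddMeas g) (hh : BddMeas h) : BddMeas fun x => g x * h x := by
  obtain ⟨hg, K, hK⟩ := hg
  obtain ⟨hh, L, hL⟩ := hh
  refine of_le (K := K * L) (hg.mul hh) fun x => ?_
  rw [abs_mul]
  exact mul_le_mul (hK x) (hL x) (abs_nonneg _) ((abs_nonneg _).trans (hK x))

theorem comp (hg : BddMeas g) {f : β → α} (hf : Measurable f) : BddMeas fun x => g (f x) :=
  ⟨hg.1.comp hf, hg.2.imp fun _ hK x => hK (f x)⟩

theorem indicator {s : Set α} (hs : MeasurableSet s) : BddMeas (s.indicator (1 : α → ℝ)) := by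
  refine of_le (K := 1) (measurable_one.indicator hs) fun x => ?_
  by_cases hx : x ∈ s <;> simp [hx]

theorem prod {ι : Type*} {F : ι → α → ℝ} (s : Finset ι) (hF : ∀ i, BddMeas (F i)) :
    BddMeas fun x => ∏ i ∈ s, F i x := by
  classical
  induction s using Finset.induction_on with
  | empty => simpa using const 1
  | insert a s ha ih =>
    simp only [Finset.prod_insert ha]
    exact (hF a).mul ih

end BddMeas

variable {M : Type*} [MeasurableSpace M]

/-- The Markov operator of a kernel. -/
noncomputable def avg (p : Kernel M M) (g : M → ℝ) : M → ℝ := fun x => ∫ y, g y ∂(p x)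

/-- The Markov operator of a kernel on functions with values in `[0, ∞]`. -/
noncomputable def lavg (p : Kernel M M) (g : M → ℝ≥0∞) : M → ℝ≥0∞ := fun x => ∫⁻ y, g y ∂(p x)

theorem measurable_lavg (p : Kernel M M) {g : M → ℝ≥0∞} (hg : Measurable g) :
    Measurable (lavg p g) := hg.lintegral_kernel

theorem measurable_lavg_iterate (p : Kernel M M) {g : M → ℝ≥0∞} (hg : Measurable g) (n : ℕ) :
    Measurable ((lavg p)^[n] g) := by
  induction n with
  | zero => exact hg
  | succ n ih => rw [Function.iterate_succ_apply']; exact measurable_lavg p ih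

section avg

variable {p : Kernel M M} [IsMarkovKernel p] {μ : Measure M} [IsProbabilityMeasure μ]
  {g h : M → ℝ}

theorem abs_avg_le {K : ℝ} (hK : ∀ x, |g x| ≤ K) (x : M) : |avg p g x| ≤ K := by
  have := norm_integral_le_of_norm_le_const (μ := p x) (f := g) (ae_of_all _ hK)
  simpa [avg] using this

theorem BddMeas.avg (hg : BddMeas g) : BddMeas (avg p g) := by
  obtain ⟨hm, K, hK⟩ := hg
  exact .of_le (hm.stronglyMeasurable.integral_kernel.measurable) (abs_avg_le hK)

theorem BddMeas.avg_iterate (hg : BddMeas g) (n : ℕ) : BddMeas ((RareEvents.avg p)^[n] g) := by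
  induction n with
  | zero => exact hg
  | succ n ih => rw [Function.iterate_succ_apply']; exact ih.avg

theorem avg_sub (hg : BddMeas g) (hh : BddMeas h) (x : M) :
    avg p (fun y => g y - h y) x = avg p g x - avg p h x :=
  integral_sub (hg.integrable _) (hh.integrable _)

theorem avg_const (a : ℝ) : avg p (fun _ => a) = fun _ => a := by
  ext x; simp [avg]

theorem avg_iterate_sub_const (hg : BddMeas g) (a : ℝ) (n : ℕ) :
    (avg p)^[n] (fun y => g y - a) = fun x => (avg p)^[n] g x - a := by
  induction n with
  | zero => rfl
  | succ n ih =>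
    rw [Function.iterate_succ_apply', ih, Function.iterate_succ_apply']
    ext x
    rw [avg_sub (hg.avg_iterate n) (.const a), avg_const]

theorem avg_iterate_neg (n : ℕ) :
    (avg p)^[n] (fun y => - g y) = fun x => - (avg p)^[n] g x := by
  induction n with
  | zero => rfl
  | succ n ih =>
    rw [Function.iterate_succ_apply', ih, Function.iterate_succ_apply']
    ext x
    exact integral_neg _

/-- The measure `μ` is the `μ`-average of the `p x`, so a `μ`-null set is `p x`-null for almost
every `x`. This lets almost everywhere estimates survive iteration of the kernel. -/
theorem ae_ae_of_invariant (hμ : p.Invariant μ) {s : M → Prop} (hs : ∀ᵐ x ∂μ, s x) :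
    ∀ᵐ x ∂μ, ∀ᵐ y ∂(p x), s y :=
  Measure.ae_ae_of_ae_comp (by rwa [hμ.def])

theorem avg_congr_ae (hμ : p.Invariant μ) (hgh : g =ᵐ[μ] h) : avg p g =ᵐ[μ] avg p h :=
  (ae_ae_of_invariant hμ hgh).mono fun _ hx => integral_congr_ae hx

theorem avg_iterate_congr_ae (hμ : p.Invariant μ) (hgh : g =ᵐ[μ] h) (n : ℕ) :
    (avg p)^[n] g =ᵐ[μ] (avg p)^[n] h := by
  induction n with
  | zero => exact hgh
  | succ n ih =>
    rw [Function.iterate_succ_apply', Function.iterate_succ_apply']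
    exact avg_congr_ae hμ ih

theorem abs_avg_le_ae (hμ : p.Invariant μ) {b : ℝ} (hb : ∀ᵐ x ∂μ, |g x| ≤ b) :
    ∀ᵐ x ∂μ, |avg p g x| ≤ b := by
  filter_upwards [ae_ae_of_invariant hμ hb] with x hx
  simpa [avg] using norm_integral_le_of_norm_le_const (μ := p x) (f := g) hx

theorem abs_avg_iterate_le_ae (hμ : p.Invariant μ) {b : ℝ} (hb : ∀ᵐ x ∂μ, |g x| ≤ b) (n : ℕ) :
    ∀ᵐ x ∂μ, |(avg p)^[n] g x| ≤ b := by
  induction n with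
  | zero => exact hb
  | succ n ih => rw [Function.iterate_succ_apply']; exact abs_avg_le_ae hμ ih

theorem integral_avg (hμ : p.Invariant μ) (hg : BddMeas g) : ∫ x, avg p g x ∂μ = ∫ x, g x ∂μ := by
  conv_rhs => rw [← hμ.def, ← Measure.snd_compProd, Measure.snd,
    integral_map measurable_snd.aemeasurable hg.1.aestronglyMeasurable,
    Measure.integral_compProd ((hg.comp measurable_snd).integrable _)]
  rfl

theorem integral_avg_iterate (hμ : p.Invariant μ) (hg : BddMeas g) (n : ℕ) :
    ∫ x, (avg p)^[n] g x ∂μ = ∫ x, g x ∂μ := by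
  induction n with
  | zero => rfl
  | succ n ih => rw [Function.iterate_succ_apply', integral_avg hμ (hg.avg_iterate n), ih]

theorem avg_iterate_nonneg (hg : ∀ x, 0 ≤ g x) (n : ℕ) (x : M) : 0 ≤ (avg p)^[n] g x := by
  induction n generalizing x with
  | zero => exact hg x
  | succ n ih => rw [Function.iterate_succ_apply']; exact integral_nonneg ih

theorem ofReal_avg_iterate (hg : BddMeas g) (h0 : ∀ x, 0 ≤ g x) (n : ℕ) (x : M) :
    ENNReal.ofReal ((avg p)^[n] g x) = (lavg p)^[n] (fun y => ENNReal.ofReal (g y)) x := by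
  induction n generalizing x with
  | zero => rfl
  | succ n ih =>
    rw [Function.iterate_succ_apply', Function.iterate_succ_apply']
    simp only [lavg, ← ih]
    exact ofReal_integral_eq_lintegral_ofReal ((hg.avg_iterate n).integrable _)
      (ae_of_all _ (avg_iterate_nonneg h0 n))

/-- The kernel has density at most `C` with respect to `μ`. -/
def HasDensityBound (p : Kernel M M) (μ : Measure M) (C : ℝ) : Prop :=
  ∀ A, MeasurableSet A → ∀ᵐ x ∂μ, p x A ≤ ENNReal.ofReal C * μ A

/-- Doeblin's condition for `N` steps of the kernel. -/
def Doeblin (p : Kernel M M) (μ : Measure M) (N : ℕ) (c : ℝ) : Prop :=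
  ∀ g : M → ℝ≥0∞, Measurable g →
    ∀ᵐ x ∂μ, ENNReal.ofReal c * ∫⁻ y, g y ∂μ ≤ (lavg p)^[N] g x

/-! ### Geometric contraction from Doeblin's condition -/

variable {N : ℕ} {c C : ℝ}

theorem Doeblin.le_avg_iterate (hD : Doeblin p μ N c) (hc : 0 ≤ c) (hg : BddMeas g)
    (h0 : ∀ x, 0 ≤ g x) : ∀ᵐ x ∂μ, c * ∫ y, g y ∂μ ≤ (avg p)^[N] g x := by
  filter_upwards [hD (fun y => ENNReal.ofReal (g y)) hg.1.ennreal_ofReal] with x hx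
  rw [← ofReal_avg_iterate hg h0,
    ← ofReal_integral_eq_lintegral_ofReal (hg.integrable _) (ae_of_all _ h0),
    ← ENNReal.ofReal_mul hc] at hx
  exact (ENNReal.ofReal_le_ofReal_iff (avg_iterate_nonneg h0 N x)).1 hx

theorem Doeblin.le_one (hD : Doeblin p μ N c) (hc : 0 ≤ c) : c ≤ 1 := by
  have h := hD.le_avg_iterate hc (.const 1) fun _ => zero_le_one
  have h1 : ∀ n, (avg p)^[n] (fun _ => (1 : ℝ)) = fun _ => 1 := fun n => by
    induction n with
    | zero => rfl
    | succ n ih => rw [Function.iterate_succ_apply', ih, avg_const]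
  rw [h1] at h
  obtain ⟨x, hx⟩ := h.exists
  simpa using hx

/-- The minorisation is applied to `g + b ≥ 0`, which has mean `b`: its `N`-step average is at least
`c * b`. -/
theorem Doeblin.neg_le_avg_iterate (hD : Doeblin p μ N c) (hc : 0 ≤ c) (hg : BddMeas g)
    {b : ℝ} (hb : ∀ x, |g x| ≤ b) (h0 : ∫ x, g x ∂μ = 0) :
    ∀ᵐ x ∂μ, -((1 - c) * b) ≤ (avg p)^[N] g x := by
  have h := hD.le_avg_iterate hc (g := fun x => g x - (-b)) (hg.sub (.const _))
    fun x => by linarith [neg_le_of_abs_le (hb x)]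
  filter_upwards [h] with x hx
  rw [avg_iterate_sub_const hg, integral_sub (hg.integrable _) (integrable_const _), h0] at hx
  simp at hx
  linarith

theorem Doeblin.abs_avg_iterate_le (hD : Doeblin p μ N c) (hμ : p.Invariant μ) (hc : 0 ≤ c)
    (hg : BddMeas g) {b : ℝ} (hb : ∀ᵐ x ∂μ, |g x| ≤ b) (h0 : ∫ x, g x ∂μ = 0) :
    ∀ᵐ x ∂μ, |(avg p)^[N] g x| ≤ (1 - c) * b := by
  -- The bound by `b` holds only almost everywhere, while the one-sided estimate wants it
  -- everywhere. Truncation changes `g` on a null set and, by invariance, its iterates too.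
  set g' : M → ℝ := fun x => max (-b) (min b (g x)) with hg'
  have hb0 : 0 ≤ b := by
    obtain ⟨x, hx⟩ := hb.exists
    exact (abs_nonneg _).trans hx
  have hgg : g' =ᵐ[μ] g := hb.mono fun x hx => by
    rw [hg']
    simp only
    rw [min_eq_right (le_of_abs_le hx), max_eq_right (neg_le_of_abs_le hx)]
  have hb' : ∀ x, |g' x| ≤ b := fun x =>
    abs_le.2 ⟨le_max_left _ _, max_le (by linarith) (min_le_left _ _)⟩
  have hm' : BddMeas g' :=
    .of_le (measurable_const.max (measurable_const.min hg.1)) hb'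
  have h0' : ∫ x, g' x ∂μ = 0 := by rw [integral_congr_ae hgg, h0]
  have h1 := hD.neg_le_avg_iterate hc hm' hb' h0'
  have h2 := hD.neg_le_avg_iterate hc hm'.neg (b := b) (by simpa only [abs_neg] using hb')
    (by rw [integral_neg, h0', neg_zero])
  filter_upwards [h1, h2, avg_iterate_congr_ae hμ hgg N] with x h1 h2 h3
  rw [avg_iterate_neg] at h2
  rw [← h3, abs_le]
  exact ⟨h1, by linarith⟩

/-- Complete blocks of `N` steps contract; the remaining `t % N` steps do not increase the essential
supremum. -/
theorem Doeblin.abs_avg_iterate_le_pow (hD : Doeblin p μ N c) (hμ : p.Invariant μ) (hc : 0 ≤ c)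
    (hg : BddMeas g) {b : ℝ} (hb : ∀ᵐ x ∂μ, |g x| ≤ b) (h0 : ∫ x, g x ∂μ = 0) (t : ℕ) :
    ∀ᵐ x ∂μ, |(avg p)^[t] g x| ≤ (1 - c) ^ (t / N) * b := by
  have key : ∀ k, ∀ᵐ x ∂μ, |(avg p)^[N * k] g x| ≤ (1 - c) ^ k * b := by
    intro k
    induction k with
    | zero => simpa using hb
    | succ k ih =>
      have := hD.abs_avg_iterate_le hμ hc (hg.avg_iterate (N * k)) ih
        (by rw [integral_avg_iterate hμ hg, h0])
      rw [← Function.iterate_add_apply, add_comm N, ← mul_add_one] at this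
      rwa [pow_succ', mul_assoc]
  have := abs_avg_iterate_le_ae hμ (key (t / N)) (t % N)
  rwa [← Function.iterate_add_apply, Nat.mod_add_div] at this

/-- Both `p x A` and `μ A` lie between `0` and `C * μ A`, the latter since `1 ≤ C`. One step of the
kernel thus makes the deviation of an indicator from its mean of order `μ A`. -/
theorem HasDensityBound.abs_avg_indicator_sub_le (hU : HasDensityBound p μ C) (hC : 1 ≤ C)
    {A : Set M} (hA : MeasurableSet A) :
    ∀ᵐ x ∂μ, |avg p (A.indicator 1) x| ≤ C * μ.real A ∧
      |avg p (fun y => A.indicator 1 y - μ.real A) x| ≤ C * μ.real A := by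
  filter_upwards [hU A hA] with x hx
  have h1 : avg p (A.indicator 1) x = (p x).real A := integral_indicator_one hA
  have h2 : (p x).real A ≤ C * μ.real A := by
    have := ENNReal.toReal_mono (ENNReal.mul_ne_top ENNReal.ofReal_ne_top (measure_ne_top _ _)) hx
    rwa [ENNReal.toReal_mul, ENNReal.toReal_ofReal (by linarith)] at this
  have h3 : μ.real A ≤ C * μ.real A := le_mul_of_one_le_left measureReal_nonneg hC
  have h4 : (0 : ℝ) ≤ (p x).real A := measureReal_nonneg
  have h5 : (0 : ℝ) ≤ μ.real A := measureReal_nonneg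
  rw [avg_sub (.indicator hA) (.const _), avg_const, h1]
  exact ⟨by rwa [abs_of_nonneg h4], abs_le.2 ⟨by linarith, by linarith⟩⟩

end avg

/-! ### The Markov property -/

section chain

variable {M Ω : Type*} [MeasurableSpace M] [MeasurableSpace Ω] {P : Measure Ω}
  [IsProbabilityMeasure P] {p : Kernel M M} [IsMarkovKernel p] {μ : Measure M}
  [IsProbabilityMeasure μ] {Z : ℕ → Ω → M}

/-- `H` is a bounded measurable function of `Z 0, …, Z m`. -/
def IsPast (Z : ℕ → Ω → M) (m : ℕ) (H : Ω → ℝ) : Prop :=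
  ∃ H' : (Fin (m + 1) → M) → ℝ, BddMeas H' ∧ H = fun ω => H' fun i => Z i ω

namespace IsPast

variable {m : ℕ} {H K : Ω → ℝ}

theorem bddMeas (hH : IsPast Z m H) (hZ : ∀ n, Measurable (Z n)) : BddMeas H := by
  obtain ⟨H', hH', rfl⟩ := hH
  exact hH'.comp (measurable_pi_lambda _ fun i => hZ i)

theorem mono (hH : IsPast Z m H) {n : ℕ} (hmn : m ≤ n) : IsPast Z n H := by
  obtain ⟨H', hH', rfl⟩ := hH
  exact ⟨fun v => H' fun i => v (Fin.castLE (by omega) i),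
    hH'.comp (measurable_pi_lambda _ fun i => measurable_pi_apply _), rfl⟩

theorem apply {h : M → ℝ} (hh : BddMeas h) {i : ℕ} (hi : i ≤ m) :
    IsPast Z m fun ω => h (Z i ω) :=
  ⟨fun v => h (v ⟨i, by omega⟩), hh.comp (measurable_pi_apply _), rfl⟩

theorem mul (hH : IsPast Z m H) (hK : IsPast Z m K) : IsPast Z m fun ω => H ω * K ω := by
  obtain ⟨H', hH', rfl⟩ := hH
  obtain ⟨K', hK', rfl⟩ := hK
  exact ⟨_, hH'.mul hK', rfl⟩

theorem prod {h : ℕ → M → ℝ} (hh : ∀ i, BddMeas (h i)) {n : ℕ} (hn : n ≤ m + 1) :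
    IsPast Z m fun ω => ∏ i ∈ Finset.range n, h i (Z i ω) := by
  induction n with
  | zero => exact ⟨fun _ => 1, .const 1, by simp⟩
  | succ n ih =>
    simp only [Finset.prod_range_succ]
    exact (ih (by omega)).mul (apply (hh n) (by omega))

end IsPast

namespace IsMarkovChain

variable (hZ : IsMarkovChain P p μ Z)

include hZ

theorem map_eq (hμ : p.Invariant μ) (n : ℕ) : P.map (Z n) = μ := by
  induction n with
  | zero => exact hZ.initial
  | succ n ih =>
    ext A hA
    have h := hZ.transition n univ A .univ hA
    simp only [mem_univ, true_and, Set.ofPred_true, Measure.restrict_univ] at h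
    rw [Measure.map_apply (hZ.measurable _) hA]
    change P {ω | Z (n + 1) ω ∈ A} = _
    rw [h, ← lintegral_map (p.measurable_coe hA) (hZ.measurable n), ih,
      ← Measure.bind_apply hA p.aemeasurable, hμ.def]

/-- The transition property determines the joint law of past and next state on rectangles, hence
everywhere. As a composition-product this law can be integrated against functions, not only sets. -/
theorem map_past (n : ℕ) :
    P.map (fun ω => ((fun i : Fin (n + 1) => Z i ω), Z (n + 1) ω)) =
      (P.map fun ω (i : Fin (n + 1)) => Z i ω) ⊗ₘ
        p.comap (fun v : Fin (n + 1) → M => v (Fin.last n)) (measurable_pi_apply _) := by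
  have hm : Measurable fun ω (i : Fin (n + 1)) => Z i ω :=
    measurable_pi_lambda _ fun i => hZ.measurable i
  have : IsProbabilityMeasure (P.map fun ω (i : Fin (n + 1)) => Z i ω) :=
    Measure.isProbabilityMeasure_map hm.aemeasurable
  have := Measure.isProbabilityMeasure_map (μ := P) (hm.prodMk (hZ.measurable (n + 1))).aemeasurable
  refine Measure.ext_prod fun {B A} hB hA => ?_
  rw [Measure.map_apply (hm.prodMk (hZ.measurable _)) (hB.prod hA),
    Measure.compProd_apply_prod hB hA]
  refine (hZ.transition n B A hB hA).trans ?_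
  rw [setLIntegral_map hB (Kernel.measurable_coe _ hA) hm]
  rfl

theorem integral_succ {m : ℕ} {H : Ω → ℝ} (hH : IsPast Z m H) {g : M → ℝ} (hg : BddMeas g) :
    ∫ ω, H ω * g (Z (m + 1) ω) ∂P = ∫ ω, H ω * avg p g (Z m ω) ∂P := by
  obtain ⟨H', hH', rfl⟩ := hH
  have hm : Measurable fun ω (i : Fin (m + 1)) => Z i ω :=
    measurable_pi_lambda _ fun i => hZ.measurable i
  have : IsProbabilityMeasure (P.map fun ω (i : Fin (m + 1)) => Z i ω) :=
    Measure.isProbabilityMeasure_map hm.aemeasurable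
  have hb : BddMeas fun q : (Fin (m + 1) → M) × M => H' q.1 * g q.2 :=
    (hH'.comp measurable_fst).mul (hg.comp measurable_snd)
  have h1 := integral_map (μ := P) (hm.prodMk (hZ.measurable (m + 1))).aemeasurable
    hb.1.aestronglyMeasurable
  rw [hZ.map_past m, Measure.integral_compProd (hb.integrable _)] at h1
  rw [← h1]
  simp only [integral_const_mul, Kernel.comap_apply]
  rw [integral_map hm.aemeasurable]
  · rfl
  · exact (hH'.mul (hg.avg.comp (measurable_pi_apply _))).1.aestronglyMeasurable

theorem integral_add {m : ℕ} {H : Ω → ℝ} (hH : IsPast Z m H) {g : M → ℝ} (hg : BddMeas g)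
    (t : ℕ) : ∫ ω, H ω * g (Z (m + t) ω) ∂P = ∫ ω, H ω * (avg p)^[t] g (Z m ω) ∂P := by
  induction t generalizing g with
  | zero => rfl
  | succ t ih =>
    rw [← add_assoc, hZ.integral_succ (hH.mono (by omega)) hg, ih hg.avg, Function.iterate_succ_apply]

theorem ae_apply (hμ : p.Invariant μ) {s : M → Prop} (hs : ∀ᵐ x ∂μ, s x) (n : ℕ) :
    ∀ᵐ ω ∂P, s (Z n ω) :=
  ae_of_ae_map (hZ.measurable n).aemeasurable (by rwa [hZ.map_eq hμ n])

theorem integral_apply (hμ : p.Invariant μ) {g : M → ℝ} (hg : BddMeas g) (n : ℕ) :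
    ∫ ω, g (Z n ω) ∂P = ∫ x, g x ∂μ := by
  rw [← hZ.map_eq hμ n, integral_map (hZ.measurable n).aemeasurable hg.1.aestronglyMeasurable]

/-- The expectation of a product over the future of time `s`, given the past, is a function of
`Z s`. -/
theorem exists_future (h : ℕ → M → ℝ) (hh : ∀ i, BddMeas (h i)) (h0 : ∀ i x, 0 ≤ h i x)
    (h1 : ∀ i x, h i x ≤ 1) (L : ℕ) :
    ∃ Φ : M → ℝ, BddMeas Φ ∧ (∀ x, |Φ x| ≤ 1) ∧ (∀ x, 0 ≤ Φ x) ∧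
      ∀ (s : ℕ) (H : Ω → ℝ), IsPast Z s H →
      ∫ ω, H ω * ∏ i ∈ Finset.range L, h i (Z (i + s) ω) ∂P = ∫ ω, H ω * Φ (Z s ω) ∂P := by
  induction L generalizing h with
  | zero => exact ⟨fun _ => 1, .const 1, by simp, by simp, by simp⟩
  | succ L ih =>
    obtain ⟨Φ, hΦ, hΦ1, hΦ0, hH⟩ := ih (fun i => h (i + 1)) (fun i => hh _) (fun i => h0 _)
      (fun i => h1 _)
    -- The factor at time `s` joins the past of time `s + 1`, and the kernel carries the rest back
    -- to `Z s`. The same `Φ` serves every `s`; `D₃` compares the shifts `s` and `0`.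
    refine ⟨fun x => h 0 x * avg p Φ x, (hh 0).mul hΦ.avg, fun x => ?_, fun x => ?_,
      fun s H hHs => ?_⟩
    · rw [abs_mul]
      exact mul_le_one₀ ((abs_of_nonneg (h0 0 x)).trans_le (h1 0 x)) (abs_nonneg _)
        (abs_avg_le hΦ1 x)
    · exact mul_nonneg (h0 0 x) (integral_nonneg hΦ0)
    · have hP : IsPast Z s fun ω => H ω * h 0 (Z s ω) := hHs.mul (.apply (hh 0) le_rfl)
      have e1 := hH (s + 1) (fun ω => H ω * h 0 (Z s ω)) (hP.mono (by omega))
      rw [hZ.integral_succ hP hΦ] at e1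
      calc _ = ∫ ω, H ω * h 0 (Z s ω) * ∏ i ∈ Finset.range L, h (i + 1) (Z (i + (s + 1)) ω) ∂P := by
            congr 1
            ext ω
            rw [Finset.prod_range_succ', zero_add, mul_assoc]
            simp only [add_right_comm _ 1 s, add_assoc]
            ring
        _ = _ := by rw [e1]; simp only [mul_assoc]

end IsMarkovChain
end chain

/-! ### Mixing estimates and the conditions `D₃` and `D'` -/

section exceedances

variable {Ω : Type*} {X : ℕ → Ω → EReal} {u : ℝ} {A : Set ℝ} {ω : Ω}

theorem exceedances_eq_zero_iff :
    exceedances X u A ω = 0 ↔ ∀ i : ℕ, (i : ℝ) ∈ A → ¬ (u : EReal) < X i ω := by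
  simp only [exceedances, ENNReal.tsum_eq_zero, indicator_apply_eq_zero, Set.mem_ofPred_eq,
    Pi.one_apply, one_ne_zero, imp_false, not_and]

theorem exceedances_eq_sum {L : ℕ} (hL : ∀ i : ℕ, (i : ℝ) ∈ A → i < L) :
    exceedances X u A ω =
      ∑ i ∈ Finset.range L, {i : ℕ | (i : ℝ) ∈ A ∧ (u : EReal) < X i ω}.indicator 1 i := by
  refine tsum_eq_sum fun i hi => ?_
  rw [indicator_of_notMem]
  exact fun h => hi (Finset.mem_range.2 (hL i h.1))

theorem measurable_exceedances [MeasurableSpace Ω] (hX : ∀ n, Measurable (X n)) :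
    Measurable (exceedances X u A) := by
  unfold exceedances
  refine Measurable.tsum fun i => ?_
  by_cases hi : (i : ℝ) ∈ A
  · have : (fun ω => {i : ℕ | (i : ℝ) ∈ A ∧ (u : EReal) < X i ω}.indicator (1 : ℕ → ℝ≥0∞) i) =
        {ω | (u : EReal) < X i ω}.indicator 1 := by
      ext ω; simp [indicator, hi]
    rw [this]
    exact measurable_one.indicator (measurableSet_lt measurable_const (hX i))
  · simp [indicator, hi]

end exceedances

theorem InRing.nonneg {A : Set ℝ} (hA : InRing A) {x : ℝ} (hx : x ∈ A) : 0 ≤ x := by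
  obtain ⟨s, hs, rfl⟩ := hA
  simp only [mem_iUnion] at hx
  obtain ⟨I, hI, hx⟩ := hx
  exact (hs I hI).1.trans hx.1

theorem InRing.exists_lt {A : Set ℝ} (hA : InRing A) : ∃ K : ℕ, ∀ x ∈ A, x < K := by
  obtain ⟨s, hs, rfl⟩ := hA
  obtain ⟨K, hK⟩ := exists_nat_ge (∑ I ∈ s, I.2)
  refine ⟨K, fun x hx => ?_⟩
  simp only [mem_iUnion] at hx
  obtain ⟨I, hI, hx⟩ := hx
  exact hx.2.trans_le ((Finset.single_le_sum (f := fun I : ℝ × ℝ => I.2)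
    (fun J hJ => (hs J hJ).2) hI).trans hK)

section chain

variable {M Ω : Type*} [MeasurableSpace M] [MeasurableSpace Ω] {P : Measure Ω}
  [IsProbabilityMeasure P] {p : Kernel M M} [IsMarkovKernel p] {μ : Measure M}
  [IsProbabilityMeasure μ] {Z : ℕ → Ω → M} {N : ℕ} {c C : ℝ}

/-- A stationary Markov chain whose kernel has bounded density and satisfies Doeblin's condition. -/
structure IsMixingChain (P : Measure Ω) (p : Kernel M M) (μ : Measure M) (Z : ℕ → Ω → M)
    (N : ℕ) (c C : ℝ) : Prop where
  chain : IsMarkovChain P p μ Z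
  invariant : p.Invariant μ
  doeblin : Doeblin p μ N c
  bound : HasDensityBound p μ C
  N_pos : 0 < N
  c_pos : 0 < c
  one_le : 1 ≤ C

namespace IsMixingChain

variable (hZ : IsMixingChain P p μ Z N c C)

include hZ

theorem c_le_one : c ≤ 1 := hZ.doeblin.le_one hZ.c_pos.le

theorem rate_nonneg : 0 ≤ 1 - c := sub_nonneg.2 hZ.c_le_one

theorem rate_le_one : 1 - c ≤ 1 := by linarith [hZ.c_pos]

theorem tendsto_rate : Tendsto (fun t : ℕ => (1 - c) ^ (t / N)) atTop (𝓝 0) :=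
  (tendsto_pow_atTop_nhds_zero_of_lt_one hZ.rate_nonneg (by linarith [hZ.c_pos])).comp
    (Nat.tendsto_div_const_atTop hZ.N_pos.ne')

/-- Given the past, the expectation of `g (Z (m + t))` is the `t`-step average of `g` at `Z m`,
which is close to the mean by contraction. Keeping `∫ |H|` preserves the smallness of a rare past
event. -/
theorem decay {m : ℕ} {H : Ω → ℝ} (hH : IsPast Z m H) {g : M → ℝ} (hg : BddMeas g) {b : ℝ}
    (hb : ∀ᵐ x ∂μ, |g x - ∫ y, g y ∂μ| ≤ b) (t : ℕ) :
    |∫ ω, H ω * g (Z (m + t) ω) ∂P - (∫ ω, H ω ∂P) * ∫ x, g x ∂μ| ≤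
      (∫ ω, |H ω| ∂P) * ((1 - c) ^ (t / N) * b) := by
  set a := ∫ y, g y ∂μ
  have hHb := hH.bddMeas hZ.chain.measurable
  have h1 := hZ.doeblin.abs_avg_iterate_le_pow hZ.invariant hZ.c_pos.le (hg.sub (.const a)) hb
    (by rw [integral_sub (hg.integrable _) (integrable_const _)]; simp [a]) t
  rw [avg_iterate_sub_const hg] at h1
  have h2 := hZ.chain.ae_apply hZ.invariant h1 m
  have hgt : BddMeas fun ω => (avg p)^[t] g (Z m ω) :=
    (hg.avg_iterate t).comp (hZ.chain.measurable m)
  rw [hZ.chain.integral_add hH hg, ← integral_mul_const,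
    ← integral_sub ((hHb.mul hgt).integrable _) ((hHb.mul (.const a)).integrable _),
    ← integral_mul_const, ← Real.norm_eq_abs]
  refine norm_integral_le_of_norm_le ((hHb.integrable _).abs.mul_const _) ?_
  filter_upwards [h2] with ω hω
  rw [← mul_sub, norm_mul, Real.norm_eq_abs, Real.norm_eq_abs]
  exact mul_le_mul_of_nonneg_left hω (abs_nonneg _)

variable {U : Set M}

theorem integral_indicator (hU : MeasurableSet U) (n : ℕ) :
    ∫ ω, U.indicator 1 (Z n ω) ∂P = μ.real U := by
  rw [hZ.chain.integral_apply hZ.invariant (.indicator hU), integral_indicator_one hU]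

/-- One of the `t + 1` steps is spent on replacing the indicator by its average along the kernel,
which deviates from `μ U` by at most `C * μ U`. The error is then proportional to `μ U`. -/
theorem decay_indicator (hU : MeasurableSet U) {m : ℕ} {H : Ω → ℝ} (hH : IsPast Z m H)
    (h1 : ∀ ω, |H ω| ≤ 1) (t : ℕ) :
    |∫ ω, H ω * U.indicator 1 (Z (m + t + 1) ω) ∂P - (∫ ω, H ω ∂P) * μ.real U| ≤
      (1 - c) ^ (t / N) * (C * μ.real U) := by
  have hi : BddMeas (U.indicator (1 : M → ℝ)) := .indicator hU
  have hint : ∫ x, avg p (U.indicator 1) x ∂μ = μ.real U := by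
    rw [integral_avg hZ.invariant hi, integral_indicator_one hU]
  have h2 := hZ.decay hH (g := avg p (U.indicator 1)) hi.avg (b := C * μ.real U) (by
    filter_upwards [hZ.bound.abs_avg_indicator_sub_le hZ.one_le hU] with x hx
    rw [hint]
    have := hx.2
    rwa [avg_sub hi (.const _), avg_const] at this) t
  rw [hint, ← hZ.chain.integral_succ (hH.mono (by omega)) hi] at h2
  refine h2.trans (mul_le_of_le_one_left ?_ ?_)
  · exact mul_nonneg (pow_nonneg hZ.rate_nonneg _)
      (mul_nonneg (by linarith [hZ.one_le]) measureReal_nonneg)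
  · calc ∫ ω, |H ω| ∂P ≤ ∫ _, (1 : ℝ) ∂P :=
        integral_mono ((hH.bddMeas hZ.chain.measurable).integrable _).abs (integrable_const _) h1
      _ = 1 := by simp

/-- Conditioning on time `j - 1 ≥ i`, the next step hits `U` with probability at most `C * μ U`,
almost surely. -/
theorem integral_pair_le (hU : MeasurableSet U) {i j : ℕ} (hij : i < j) :
    ∫ ω, U.indicator 1 (Z i ω) * U.indicator 1 (Z j ω) ∂P ≤ C * μ.real U ^ 2 := by
  have hi : BddMeas (U.indicator (1 : M → ℝ)) := .indicator hU
  obtain ⟨j, rfl⟩ : ∃ k, j = k + 1 := ⟨j - 1, by omega⟩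
  have hH : IsPast Z j fun ω => U.indicator (1 : M → ℝ) (Z i ω) := .apply hi (by omega)
  have hae := hZ.chain.ae_apply hZ.invariant
    (hZ.bound.abs_avg_indicator_sub_le hZ.one_le hU) j
  rw [hZ.chain.integral_succ hH hi]
  calc _ ≤ ∫ ω, U.indicator 1 (Z i ω) * (C * μ.real U) ∂P := by
        refine integral_mono_ae
          (((hi.comp (hZ.chain.measurable i)).mul
            (hi.avg.comp (hZ.chain.measurable j))).integrable _)
          (((hi.comp (hZ.chain.measurable i)).mul (.const _)).integrable _) ?_
        filter_upwards [hae] with ω hω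
        exact mul_le_mul_of_nonneg_left (le_of_abs_le hω.1)
          (indicator_nonneg (fun _ _ => zero_le_one) _)
    _ = C * μ.real U ^ 2 := by
        rw [integral_mul_const, hZ.integral_indicator hU]; ring

theorem real_pair_le (hU : MeasurableSet U) {i j : ℕ} (hij : i < j) :
    P.real {ω | Z i ω ∈ U ∧ Z j ω ∈ U} ≤ C * μ.real U ^ 2 := by
  refine le_of_eq_of_le ?_ (hZ.integral_pair_le hU hij)
  refine (integral_indicator_one
    ((hZ.chain.measurable i hU).inter (hZ.chain.measurable j hU))).symm.trans ?_
  congr 1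
  ext ω
  by_cases h1 : Z i ω ∈ U <;> by_cases h2 : Z j ω ∈ U <;> simp [h1, h2, indicator]

theorem real_preimage (hU : MeasurableSet U) (n : ℕ) : P.real {ω | Z n ω ∈ U} = μ.real U := by
  rw [← hZ.integral_indicator hU n]
  exact (integral_indicator_one (hZ.chain.measurable n hU)).symm

variable {φ : M → EReal} {u : ℕ → ℝ}

/-- Absence of exceedances is a product over times, so its conditional probability is a function `Φ`
of `Z s` with values in `[0, 1]`. The claim is decay of correlations between `Φ (Z s)` and the
exceedance at time `0`. -/
theorem abs_real_sub_le (hφ : Measurable φ) (v : ℝ) {A : Set ℝ} (hA : InRing A) (s : ℕ) :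
    |P.real {ω | (v : EReal) < φ (Z 0 ω) ∧
          exceedances (fun n ω => φ (Z n ω)) v ((fun r => r + (s : ℝ)) '' A) ω = 0}
        - P.real {ω | (v : EReal) < φ (Z 0 ω)} *
          P.real {ω | exceedances (fun n ω => φ (Z n ω)) v A ω = 0}| ≤
      μ.real {x | (v : EReal) < φ x} * (1 - c) ^ (s / N) := by
  classical
  set U : Set M := {x | (v : EReal) < φ x} with hUdef
  have hU : MeasurableSet U := measurableSet_lt measurable_const hφ
  obtain ⟨L, hL⟩ := hA.exists_lt
  -- The factors at times outside `A` are trivial, so the product over `i < L` is the indicator of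
  -- no exceedance during the shifted set.
  set h : ℕ → M → ℝ := fun i => if (i : ℝ) ∈ A then Uᶜ.indicator 1 else fun _ => 1 with hh
  have hb : ∀ i, BddMeas (h i) := fun i => by
    simp only [hh]
    split_ifs
    exacts [.indicator hU.compl, .const 1]
  have h0 : ∀ i x, 0 ≤ h i x := fun i x => by
    simp only [hh]
    split_ifs
    exacts [indicator_nonneg (fun _ _ => zero_le_one) _, zero_le_one]
  have h1 : ∀ i x, h i x ≤ 1 := fun i x => by
    simp only [hh]
    split_ifs
    exacts [indicator_le' (fun _ _ => le_rfl) (fun _ _ => zero_le_one) _, le_rfl]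
  obtain ⟨Φ, hΦ, hΦ1, hΦ0, hfut⟩ := hZ.chain.exists_future h hb h0 h1 L
  have hprod : ∀ (s : ℕ) ω, ∏ i ∈ Finset.range L, h i (Z (i + s) ω) =
      {ω | exceedances (fun n ω => φ (Z n ω)) v ((fun r => r + (s : ℝ)) '' A) ω = 0}.indicator 1
        ω := by
    intro s ω
    by_cases hω : exceedances (fun n ω => φ (Z n ω)) v ((fun r => r + (s : ℝ)) '' A) ω = 0
    · rw [indicator_of_mem (by exact hω)]
      rw [exceedances_eq_zero_iff] at hω
      refine Finset.prod_eq_one fun i _ => ?_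
      simp only [hh]
      split_ifs with hi
      · rw [indicator_of_mem]
        · rfl
        · exact hω (i + s) ⟨i, hi, by push_cast; rfl⟩
      · rfl
    · rw [indicator_of_notMem (by exact hω)]
      rw [exceedances_eq_zero_iff] at hω
      push Not at hω
      obtain ⟨k, ⟨r, hr, hrk⟩, hk⟩ := hω
      have hsk : s ≤ k := by
        have := hA.nonneg hr
        have : (s : ℝ) ≤ k := by simp only at hrk; linarith
        exact_mod_cast this
      have hrk' : r = ((k - s : ℕ) : ℝ) := by
        rw [Nat.cast_sub hsk]; simp only at hrk; linarith
      refine Finset.prod_eq_zero (i := k - s) ?_ ?_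
      · rw [Finset.mem_range]
        have := hL r hr
        rw [hrk'] at this
        exact_mod_cast this
      · simp only [hh]
        rw [if_pos (hrk' ▸ hr), Nat.sub_add_cancel hsk, indicator_of_notMem]
        exact fun h => h hk
  have hmX : ∀ n, Measurable fun ω => φ (Z n ω) := fun n => hφ.comp (hZ.chain.measurable n)
  have hE : ∀ A : Set ℝ, MeasurableSet
      {ω | exceedances (fun n ω => φ (Z n ω)) v A ω = 0} := fun A =>
    measurable_exceedances hmX (measurableSet_singleton 0)
  have e1 : P.real {ω | (v : EReal) < φ (Z 0 ω) ∧
      exceedances (fun n ω => φ (Z n ω)) v ((fun r => r + (s : ℝ)) '' A) ω = 0} =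
      ∫ ω, U.indicator 1 (Z 0 ω) * Φ (Z (0 + s) ω) ∂P := by
    rw [zero_add, ← hfut s (fun ω => U.indicator 1 (Z 0 ω)) (.apply (.indicator hU) (Nat.zero_le _))]
    refine (integral_indicator_one ((hZ.chain.measurable 0 hU).inter (hE _))).symm.trans ?_
    congr 1
    ext ω
    rw [hprod, inter_indicator_one]
    rfl
  have e2 : P.real {ω | exceedances (fun n ω => φ (Z n ω)) v A ω = 0} = ∫ x, Φ x ∂μ := by
    have hf := hfut 0 (fun _ => 1) ⟨fun _ => 1, .const 1, rfl⟩
    simp only [one_mul] at hf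
    rw [hZ.chain.integral_apply hZ.invariant hΦ] at hf
    rw [← hf, ← integral_indicator_one (hE _)]
    congr 1
    ext ω
    rw [hprod]
    simp
  have e3 : P.real {ω | (v : EReal) < φ (Z 0 ω)} = ∫ ω, U.indicator 1 (Z 0 ω) ∂P := by
    rw [hZ.integral_indicator hU]
    exact hZ.real_preimage hU 0
  have hint0 : 0 ≤ ∫ x, Φ x ∂μ := integral_nonneg hΦ0
  have hint1 : ∫ x, Φ x ∂μ ≤ 1 := by
    calc _ ≤ ∫ _, (1 : ℝ) ∂μ :=
          integral_mono (hΦ.integrable _) (integrable_const _) fun x => le_of_abs_le (hΦ1 x)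
      _ = 1 := by simp
  have hd := hZ.decay (m := 0) (H := fun ω => U.indicator 1 (Z 0 ω)) (.apply (.indicator hU) le_rfl)
    hΦ (b := 1) (ae_of_all _ fun x => abs_le.2
      ⟨by linarith [hΦ0 x], by linarith [le_of_abs_le (hΦ1 x)]⟩) s
  rw [e1, e2, e3]
  refine hd.trans_eq ?_
  have : ∀ ω, |U.indicator (1 : M → ℝ) (Z 0 ω)| = U.indicator 1 (Z 0 ω) := fun ω =>
    abs_of_nonneg (indicator_nonneg (fun _ _ => zero_le_one) _)
  simp only [this]
  rw [hZ.integral_indicator hU, mul_one]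

theorem exists_condD3 (hφ : Measurable φ) {τ : ℝ}
    (hu : Tendsto (fun n : ℕ => (n : ℝ) * μ.real {x | (u n : EReal) < φ x}) atTop (𝓝 τ)) :
    ∃ t : ℕ → ℕ, CondD3 P (fun n ω => φ (Z n ω)) u t := by
  have hsq : Tendsto Nat.sqrt atTop atTop :=
    tendsto_atTop.2 fun b => (eventually_ge_atTop (b * b)).mono fun n hn => Nat.le_sqrt.2 hn
  -- Any `t` with `t n → ∞` and `t n = o(n)` would do, since `n * γ n (t n)` is `n * μ(U_n)`, which
  -- converges to `τ`, times a rate tending to `0`.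
  refine ⟨Nat.sqrt, ?_, fun n s => μ.real {x | (u n : EReal) < φ x} * (1 - c) ^ (s / N),
    fun A hA n s => hZ.abs_real_sub_le hφ (u n) hA s, fun n s t hst => ?_, ?_⟩
  · refine squeeze_zero' (g := fun n : ℕ => 1 / (Nat.sqrt n : ℝ))
      (Eventually.of_forall fun n => by positivity) ?_
      ((tendsto_const_div_atTop_nhds_zero_nat 1).comp hsq)
    filter_upwards [eventually_ge_atTop 1] with n hn
    have h1 : 0 < Nat.sqrt n := Nat.sqrt_pos.2 hn
    rw [div_le_div_iff₀ (by exact_mod_cast hn) (by exact_mod_cast h1), one_mul]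
    exact_mod_cast Nat.sqrt_le n
  · exact mul_le_mul_of_nonneg_left
      (pow_le_pow_of_le_one hZ.rate_nonneg hZ.rate_le_one (Nat.div_le_div_right hst))
      measureReal_nonneg
  · simp only [← mul_assoc]
    simpa using hu.mul (hZ.tendsto_rate.comp hsq)

theorem condD' (hφ : Measurable φ) {τ : ℝ}
    (hu : Tendsto (fun n : ℕ => (n : ℝ) * μ.real {x | (u n : EReal) < φ x}) atTop (𝓝 τ))
    {t : ℕ → ℕ} (ht : CondD3 P (fun n ω => φ (Z n ω)) u t) :
    CondD' P (fun n ω => φ (Z n ω)) u t := by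
  set δ : ℕ → ℝ := fun n => μ.real {x | (u n : EReal) < φ x}
  have hδ0 : ∀ n, 0 ≤ δ n := fun n => measureReal_nonneg
  have ht1 : Tendsto (fun n : ℕ => ((t n + 1 : ℕ) : ℝ) / n) atTop (𝓝 0) := by
    have := ht.1.add (tendsto_const_div_atTop_nhds_zero_nat 1)
    simpa [add_div] using this
  have hdiv : Tendsto (fun n => n / (t n + 1)) atTop atTop := by
    refine tendsto_atTop.2 fun b => ?_
    have hb : (0 : ℝ) < 1 / (b + 1) := by positivity
    filter_upwards [ht1.eventually (gt_mem_nhds hb), eventually_ge_atTop 1] with n hn hn1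
    rw [div_lt_div_iff₀ (by exact_mod_cast hn1) (by positivity), one_mul] at hn
    rw [Nat.le_div_iff_mul_le (Nat.succ_pos _)]
    have : (t n + 1) * (b + 1) < n := by exact_mod_cast hn
    nlinarith
  have hsq : Tendsto Nat.sqrt atTop atTop :=
    tendsto_atTop.2 fun b => (eventually_ge_atTop (b * b)).mono fun n hn => Nat.le_sqrt.2 hn
  -- This choice gives `k² * (t + 1) ≤ n`, hence `k * t / n ≤ 1 / k`; the `+ 1` avoids division by
  -- zero.
  set k : ℕ → ℕ := fun n => Nat.sqrt (n / (t n + 1)) with hk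
  have hkt : Tendsto k atTop atTop := hsq.comp hdiv
  refine ⟨k, hkt, ?_, ?_⟩
  · refine squeeze_zero' (g := fun n => 1 / (k n : ℝ)) (Eventually.of_forall fun n => by positivity)
      ?_ ((tendsto_const_div_atTop_nhds_zero_nat 1).comp hkt)
    filter_upwards [eventually_ge_atTop 1, hkt.eventually_ge_atTop 1] with n hn hkn
    rw [div_le_div_iff₀ (by exact_mod_cast hn) (by exact_mod_cast hkn), one_mul]
    have h1 : k n * k n ≤ n / (t n + 1) := Nat.sqrt_le _
    have h2 : k n * k n * (t n + 1) ≤ n :=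
      (Nat.mul_le_mul_right _ h1).trans (Nat.div_mul_le_self _ _)
    have h3 : k n * t n * k n ≤ n := by nlinarith
    exact_mod_cast h3
  -- At most `n / k` pairs, each of probability at most `C * δ²`, and `n * δ` stays bounded.
  · refine squeeze_zero' (g := fun n : ℕ => C * ((n * δ n) ^ 2 * (1 / (k n : ℝ))))
      (Eventually.of_forall fun n => mul_nonneg (Nat.cast_nonneg n)
        (Finset.sum_nonneg fun j _ => measureReal_nonneg)) ?_ ?_
    · filter_upwards [hkt.eventually_ge_atTop 1] with n hkn
      have hk0 : (0 : ℝ) < k n := by exact_mod_cast hkn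
      have h1 : ∑ j ∈ Finset.Icc 1 (n / k n),
          P.real {ω | (u n : EReal) < φ (Z 0 ω) ∧ (u n : EReal) < φ (Z j ω)} ≤
          (n / k n : ℕ) * (C * δ n ^ 2) := by
        have := Finset.sum_le_card_nsmul (Finset.Icc 1 (n / k n)) (fun j =>
          P.real {ω | (u n : EReal) < φ (Z 0 ω) ∧ (u n : EReal) < φ (Z j ω)}) (C * δ n ^ 2)
          fun j hj => hZ.real_pair_le (U := {x | (u n : EReal) < φ x})
            (measurableSet_lt measurable_const hφ) (i := 0) (j := j)
            (by rw [Finset.mem_Icc] at hj; omega)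
        simpa using this
      have h2 : ((n / k n : ℕ) : ℝ) ≤ n / k n := Nat.cast_div_le
      have h3 : 0 ≤ C * δ n ^ 2 := mul_nonneg (by linarith [hZ.one_le]) (sq_nonneg _)
      calc _ ≤ (n : ℝ) * ((n / k n) * (C * δ n ^ 2)) :=
            mul_le_mul_of_nonneg_left (h1.trans (mul_le_mul_of_nonneg_right h2 h3))
              (Nat.cast_nonneg n)
        _ = _ := by ring
    · have := ((hu.pow 2).mul ((tendsto_const_div_atTop_nhds_zero_nat 1).comp hkt)).const_mul C
      simpa using this

end IsMixingChain
end chain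

/-! ### The generating functional of the exceedances of a mixing chain -/

/-- Each step adds the defect `η` of the recursion and the error `δ²` of `exp (-x) ≈ 1 - x`; earlier
errors are multiplied by a factor in `[0, 1]` and do not grow. -/
theorem abs_sub_exp_le {G w : ℕ → ℝ} {δ η : ℝ} (hδ0 : 0 ≤ δ) (hδ1 : δ ≤ 1)
    (hw0 : ∀ i, 0 ≤ w i) (hw1 : ∀ i, w i ≤ 1) (hG0 : G 0 = 1)
    (hG : ∀ m, |G (m + 1) - (1 - w m * δ) * G m| ≤ η) (m : ℕ) :
    |G m - Real.exp (-(δ * ∑ i ∈ Finset.range m, w i))| ≤ m * (η + δ ^ 2) := by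
  induction m with
  | zero => simp [hG0]
  | succ m ih =>
    set E : ℕ → ℝ := fun m => Real.exp (-(δ * ∑ i ∈ Finset.range m, w i)) with hE
    have hE1 : E m ≤ 1 := Real.exp_le_one_iff.2
      (neg_nonpos.2 (mul_nonneg hδ0 (Finset.sum_nonneg fun i _ => hw0 i)))
    have hE0 : 0 ≤ E m := (Real.exp_pos _).le
    have hEs : E (m + 1) = Real.exp (-(w m * δ)) * E m := by
      simp only [hE]
      rw [← Real.exp_add, Finset.sum_range_succ]
      congr 1
      ring
    have hx0 : 0 ≤ w m * δ := mul_nonneg (hw0 m) hδ0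
    have hxδ : w m * δ ≤ δ := mul_le_of_le_one_left hδ0 (hw1 m)
    have hexp : |Real.exp (-(w m * δ)) - (1 - w m * δ)| ≤ δ ^ 2 := by
      have := Real.abs_exp_sub_one_sub_id_le (x := -(w m * δ))
        (by rw [abs_neg, abs_of_nonneg hx0]; linarith)
      rw [neg_sq] at this
      calc _ = |Real.exp (-(w m * δ)) - 1 - -(w m * δ)| := by ring_nf
        _ ≤ _ := this.trans (pow_le_pow_left₀ hx0 hxδ 2)
    change |G (m + 1) - E (m + 1)| ≤ _
    have e : G (m + 1) - E (m + 1) = (G (m + 1) - (1 - w m * δ) * G m) +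
        (1 - w m * δ) * (G m - E m) - (Real.exp (-(w m * δ)) - (1 - w m * δ)) * E m := by
      rw [hEs]; ring
    rw [e]
    refine (abs_sub _ _).trans ?_
    have h1 : |(1 - w m * δ) * (G m - E m)| ≤ m * (η + δ ^ 2) := by
      rw [abs_mul, abs_of_nonneg (by linarith)]
      exact (mul_le_of_le_one_left (abs_nonneg _) (by linarith)).trans ih
    have h2 : |(Real.exp (-(w m * δ)) - (1 - w m * δ)) * E m| ≤ δ ^ 2 := by
      rw [abs_mul, abs_of_nonneg hE0]
      exact (mul_le_of_le_one_right (abs_nonneg _) hE1).trans hexp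
    have h3 := (abs_add_le (G (m + 1) - (1 - w m * δ) * G m) ((1 - w m * δ) * (G m - E m)))
    have h4 := hG m
    push_cast
    linarith

section chain

variable {M Ω : Type*} [MeasurableSpace M] [MeasurableSpace Ω] {P : Measure Ω}
  [IsProbabilityMeasure P] {p : Kernel M M} [IsMarkovKernel p] {μ : Measure M}
  [IsProbabilityMeasure μ] {Z : ℕ → Ω → M} {N : ℕ} {c C : ℝ}

/-- The product of the factors `1 - w i` over the times `i < m` with `Z i ∈ U`. -/
noncomputable def visitProd (Z : ℕ → Ω → M) (U : Set M) (w : ℕ → ℝ) (m : ℕ) (ω : Ω) : ℝ :=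
  ∏ i ∈ Finset.range m, (1 - w i * U.indicator 1 (Z i ω))

variable {U : Set M} {w : ℕ → ℝ}

section

variable (hw0 : ∀ i, 0 ≤ w i) (hw1 : ∀ i, w i ≤ 1)

include hw0 hw1

theorem visit_factor_mem (i : ℕ) (x : M) :
    0 ≤ 1 - w i * U.indicator 1 x ∧ 1 - w i * U.indicator 1 x ≤ 1 := by
  by_cases hx : x ∈ U <;> simp [hx, hw0 i, hw1 i]

theorem visitProd_mem (m : ℕ) (ω : Ω) : 0 ≤ visitProd Z U w m ω ∧ visitProd Z U w m ω ≤ 1 :=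
  ⟨Finset.prod_nonneg fun i _ => (visit_factor_mem hw0 hw1 i _).1,
    Finset.prod_le_one (fun i _ => (visit_factor_mem hw0 hw1 i _).1)
      fun i _ => (visit_factor_mem hw0 hw1 i _).2⟩

/-- Factors lie in `[0, 1]` and differ from `1` only at visits, so `n` further factors lower the
product by at most the number of visits among them. -/
theorem visitProd_sub_mem (a n : ℕ) (ω : Ω) :
    0 ≤ visitProd Z U w a ω - visitProd Z U w (a + n) ω ∧
      visitProd Z U w a ω - visitProd Z U w (a + n) ω ≤
        ∑ i ∈ Finset.range n, U.indicator 1 (Z (a + i) ω) := by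
  induction n with
  | zero => simp
  | succ n ih =>
    have h1 : visitProd Z U w (a + (n + 1)) ω =
        visitProd Z U w (a + n) ω * (1 - w (a + n) * U.indicator 1 (Z (a + n) ω)) :=
      Finset.prod_range_succ _ _
    have h2 := visitProd_mem (Z := Z) (U := U) hw0 hw1 (a + n) ω
    have h3 : (0 : ℝ) ≤ U.indicator 1 (Z (a + n) ω) := indicator_nonneg (fun _ _ => zero_le_one) _
    have h4 : w (a + n) * U.indicator 1 (Z (a + n) ω) ≤ U.indicator 1 (Z (a + n) ω) :=
      mul_le_of_le_one_left h3 (hw1 _)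
    have h5 : 0 ≤ w (a + n) * U.indicator 1 (Z (a + n) ω) := mul_nonneg (hw0 _) h3
    rw [h1, Finset.sum_range_succ]
    constructor <;> nlinarith

end

namespace IsMixingChain

variable (hZ : IsMixingChain P p μ Z N c C)

include hZ

theorem bddMeas_visit (hU : MeasurableSet U) (n : ℕ) :
    BddMeas fun ω => U.indicator (1 : M → ℝ) (Z n ω) :=
  (BddMeas.indicator hU).comp (hZ.chain.measurable n)

theorem bddMeas_visitProd (hU : MeasurableSet U) (m : ℕ) : BddMeas (visitProd Z U w m) :=
  BddMeas.prod _ fun i => (BddMeas.const 1).sub ((BddMeas.const (w i)).mul (hZ.bddMeas_visit hU i))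

/-- Expanding the last factor leaves the correlation of the product with a visit at time `m`.
Dropping the last `t` factors opens a gap and costs `t * C * δ²` by the pair bound; decoupling costs
`(1 - c) ^ (t / N) * C * δ`; restoring the factors costs `t * δ * δ`. -/
theorem abs_integral_visitProd_succ (hU : MeasurableSet U) (hw0 : ∀ i, 0 ≤ w i)
    (hw1 : ∀ i, w i ≤ 1) (t m : ℕ) :
    |∫ ω, visitProd Z U w (m + 1) ω ∂P -
        (1 - w m * μ.real U) * ∫ ω, visitProd Z U w m ω ∂P| ≤
      μ.real U * ((1 - c) ^ (t / N) * C + t * (C + 1) * μ.real U) := by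
  set δ := μ.real U with hδ
  have hδ0 : 0 ≤ δ := measureReal_nonneg
  set Q := visitProd Z U w with hQ
  set I : ℕ → Ω → ℝ := fun n ω => U.indicator 1 (Z n ω) with hI
  have hI0 : ∀ n ω, 0 ≤ I n ω := fun n ω => indicator_nonneg (fun _ _ => zero_le_one) _
  have hQb : ∀ n, BddMeas (Q n) := hZ.bddMeas_visitProd hU
  have hIb : ∀ n, BddMeas (I n) := hZ.bddMeas_visit hU
  -- Either there is room for a full gap `n = t`, or `a = 0`; then the shortened product is `1` and
  -- stationarity decouples exactly.
  obtain ⟨a, n, hnt, rfl, han⟩ : ∃ a n, n ≤ t ∧ m = a + n ∧ (a = 0 ∨ n = t) :=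
    ⟨m - t, m - (m - t), by omega, by omega, by omega⟩
  have hnt' : (n : ℝ) ≤ t := by exact_mod_cast hnt
  have hsub := fun ω => visitProd_sub_mem (Z := Z) (U := U) hw0 hw1 a n ω
  have e1 : ∫ ω, Q (a + n + 1) ω ∂P =
      ∫ ω, Q (a + n) ω ∂P - w (a + n) * ∫ ω, Q (a + n) ω * I (a + n) ω ∂P := by
    rw [← integral_const_mul, ← integral_sub ((hQb _).integrable _)
      (((BddMeas.const _).mul ((hQb _).mul (hIb _))).integrable _)]
    congr 1
    ext ω
    simp only [hQ, hI, visitProd]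
    rw [Finset.prod_range_succ]
    ring
  have e2 : |∫ ω, Q a ω * I (a + n) ω ∂P - (∫ ω, Q a ω ∂P) * δ| ≤
      (1 - c) ^ (t / N) * (C * δ) := by
    have h0 : 0 ≤ (1 - c) ^ (t / N) * (C * δ) := mul_nonneg (pow_nonneg hZ.rate_nonneg _)
      (mul_nonneg (by linarith [hZ.one_le]) hδ0)
    rcases Nat.eq_zero_or_pos a with rfl | ha
    · simp only [hQ, visitProd, Finset.range_zero, Finset.prod_empty, one_mul, hI]
      rw [hZ.integral_indicator hU]
      simpa [hδ] using h0
    · obtain rfl : n = t := han.resolve_left ha.ne'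
      -- A product of `b + 1` factors depends only on `Z 0, …, Z b`, which leaves the extra step
      -- required by `decay_indicator`.
      obtain ⟨a, rfl⟩ : ∃ b, a = b + 1 := ⟨a - 1, by omega⟩
      have hp : IsPast Z a (Q (a + 1)) :=
        IsPast.prod (h := fun i x => 1 - w i * U.indicator 1 x)
          (fun i => (BddMeas.const 1).sub ((BddMeas.const (w i)).mul (.indicator hU))) le_rfl
      have := hZ.decay_indicator hU hp (fun ω => by
        have := visitProd_mem (Z := Z) (U := U) hw0 hw1 (a + 1) ω
        rw [abs_of_nonneg this.1]
        exact this.2) n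
      rwa [add_right_comm] at this
  have e3 : |∫ ω, Q (a + n) ω * I (a + n) ω ∂P - ∫ ω, Q a ω * I (a + n) ω ∂P| ≤
      t * (C * δ ^ 2) := by
    rw [abs_sub_comm, ← integral_sub (((hQb _).mul (hIb _)).integrable _)
      (((hQb _).mul (hIb _)).integrable _),
      abs_of_nonneg (integral_nonneg fun ω => by
        change 0 ≤ Q a ω * I (a + n) ω - Q (a + n) ω * I (a + n) ω
        rw [← sub_mul]
        exact mul_nonneg (hsub ω).1 (hI0 _ ω))]
    calc _ ≤ ∫ ω, ∑ i ∈ Finset.range n, I (a + i) ω * I (a + n) ω ∂P := by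
          refine integral_mono
            ((((hQb _).mul (hIb _)).sub ((hQb _).mul (hIb _))).integrable _)
            (integrable_finsetSum _ fun i _ => ((hIb _).mul (hIb _)).integrable _) fun ω => ?_
          change Q a ω * I (a + n) ω - Q (a + n) ω * I (a + n) ω ≤ _
          rw [← sub_mul, ← Finset.sum_mul]
          exact mul_le_mul_of_nonneg_right (hsub ω).2 (hI0 _ ω)
      _ = ∑ i ∈ Finset.range n, ∫ ω, I (a + i) ω * I (a + n) ω ∂P :=
          integral_finsetSum _ fun i _ => ((hIb _).mul (hIb _)).integrable _
      _ ≤ n * (C * δ ^ 2) := by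
          have := Finset.sum_le_card_nsmul (Finset.range n)
            (fun i => ∫ ω, I (a + i) ω * I (a + n) ω ∂P) (C * δ ^ 2) fun i hi =>
            hZ.integral_pair_le hU (by rw [Finset.mem_range] at hi; omega)
          simpa using this
      _ ≤ t * (C * δ ^ 2) := mul_le_mul_of_nonneg_right hnt'
          (mul_nonneg (by linarith [hZ.one_le]) (sq_nonneg _))
  have e4 : |∫ ω, Q a ω ∂P - ∫ ω, Q (a + n) ω ∂P| ≤ t * δ := by
    rw [← integral_sub ((hQb _).integrable _) ((hQb _).integrable _),
      abs_of_nonneg (integral_nonneg fun ω => (hsub ω).1)]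
    calc _ ≤ ∫ ω, ∑ i ∈ Finset.range n, I (a + i) ω ∂P :=
          integral_mono (((hQb _).sub (hQb _)).integrable _)
            (integrable_finsetSum _ fun i _ => (hIb _).integrable _) fun ω => (hsub ω).2
      _ = ∑ i ∈ Finset.range n, ∫ ω, I (a + i) ω ∂P :=
          integral_finsetSum _ fun i _ => (hIb _).integrable _
      _ = n * δ := by
          simp only [hI]
          simp only [hZ.integral_indicator hU]
          simp [hδ]
      _ ≤ t * δ := mul_le_mul_of_nonneg_right hnt' hδ0
  set G := ∫ ω, Q (a + n) ω ∂P
  set Ga := ∫ ω, Q a ω ∂P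
  set x := ∫ ω, Q (a + n) ω * I (a + n) ω ∂P
  set y := ∫ ω, Q a ω * I (a + n) ω ∂P
  have e5 : ∫ ω, Q (a + n + 1) ω ∂P - (1 - w (a + n) * δ) * G =
      -(w (a + n) * ((x - y) + (y - Ga * δ) + (Ga - G) * δ)) := by
    rw [e1]; ring
  rw [e5, abs_neg, abs_mul, abs_of_nonneg (hw0 _)]
  refine (mul_le_of_le_one_left (abs_nonneg _) (hw1 _)).trans ?_
  have e6 : |(Ga - G) * δ| ≤ t * δ * δ := by
    rw [abs_mul, abs_of_nonneg hδ0]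
    exact mul_le_mul_of_nonneg_right e4 hδ0
  have e7 := abs_add_le ((x - y) + (y - Ga * δ)) ((Ga - G) * δ)
  have e8 := abs_add_le (x - y) (y - Ga * δ)
  calc _ ≤ t * (C * δ ^ 2) + (1 - c) ^ (t / N) * (C * δ) + t * δ * δ := by linarith
    _ = _ := by ring

/-- The accumulated error is `L * δ`, which is bounded, times a term that is small when first `t` is
chosen large and then `n` is taken large for this fixed `t`. -/
theorem tendsto_integral_visitProd {U : ℕ → Set M} (hU : ∀ n, MeasurableSet (U n))
    (hδ : Tendsto (fun n => μ.real (U n)) atTop (𝓝 0)) {L : ℕ → ℕ} {K : ℝ}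
    (hL : ∀ᶠ n in atTop, L n * μ.real (U n) ≤ K) {w : ℕ → ℕ → ℝ} (hw0 : ∀ n i, 0 ≤ w n i)
    (hw1 : ∀ n i, w n i ≤ 1) {Λ : ℝ}
    (hΛ : Tendsto (fun n => μ.real (U n) * ∑ i ∈ Finset.range (L n), w n i) atTop (𝓝 Λ)) :
    Tendsto (fun n => ∫ ω, visitProd Z (U n) (w n) (L n) ω ∂P) atTop (𝓝 (Real.exp (-Λ))) := by
  set δ : ℕ → ℝ := fun n => μ.real (U n) with hδdef
  have hδ0 : ∀ n, 0 ≤ δ n := fun n => measureReal_nonneg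
  have hδ1 : ∀ n, δ n ≤ 1 := fun n => measureReal_le_one
  have hE : Tendsto (fun n => Real.exp (-(δ n * ∑ i ∈ Finset.range (L n), w n i))) atTop
      (𝓝 (Real.exp (-Λ))) := (Real.continuous_exp.tendsto _).comp hΛ.neg
  suffices h : Tendsto (fun n => ∫ ω, visitProd Z (U n) (w n) (L n) ω ∂P -
      Real.exp (-(δ n * ∑ i ∈ Finset.range (L n), w n i))) atTop (𝓝 0) by
    simpa using h.add hE
  have hbound : ∀ t n, |∫ ω, visitProd Z (U n) (w n) (L n) ω ∂P -
      Real.exp (-(δ n * ∑ i ∈ Finset.range (L n), w n i))| ≤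
      (L n * δ n) * ((1 - c) ^ (t / N) * C + (t * (C + 1) + 1) * δ n) := fun t n => by
    have := abs_sub_exp_le (G := fun m => ∫ ω, visitProd Z (U n) (w n) m ω ∂P) (hδ0 n) (hδ1 n)
      (hw0 n) (hw1 n) (by simp [visitProd])
      (fun m => hZ.abs_integral_visitProd_succ (hU n) (hw0 n) (hw1 n) t m) (L n)
    refine this.trans_eq ?_
    simp only [hδdef]
    ring
  rw [Metric.tendsto_atTop']
  have hK0 : 0 ≤ max K 0 := le_max_right _ _
  intro ε hε
  have ht : Tendsto (fun t : ℕ => max K 0 * ((1 - c) ^ (t / N) * C)) atTop (𝓝 0) := by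
    simpa using (hZ.tendsto_rate.mul_const C).const_mul (max K 0)
  obtain ⟨t, ht⟩ := (ht.eventually (gt_mem_nhds (half_pos hε))).exists
  have hn : Tendsto (fun n => max K 0 * ((t * (C + 1) + 1) * δ n)) atTop (𝓝 0) := by
    simpa using (hδ.const_mul (t * (C + 1) + 1)).const_mul (max K 0)
  obtain ⟨n₀, hn₀⟩ := eventually_atTop.1 ((hn.eventually (gt_mem_nhds (half_pos hε))).and hL)
  refine ⟨n₀, fun n hnn => ?_⟩
  obtain ⟨h1, h2⟩ := hn₀ n hnn.le
  rw [dist_zero_right, Real.norm_eq_abs]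
  have h3 : 0 ≤ (1 - c) ^ (t / N) * C + (t * (C + 1) + 1) * δ n := by
    have := hZ.one_le
    have := pow_nonneg hZ.rate_nonneg (t / N)
    have := hδ0 n
    positivity
  calc _ ≤ max K 0 * ((1 - c) ^ (t / N) * C + (t * (C + 1) + 1) * δ n) :=
        (hbound t n).trans (mul_le_mul_of_nonneg_right (h2.trans (le_max_left _ _)) h3)
    _ < ε := by rw [mul_add]; linarith

end IsMixingChain
end chain

/-! ### Convergence in distribution on compact spaces -/

/-- On a compact space, weak convergence can be tested on a point-separating set of continuous
functions that is closed under multiplication. -/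
theorem tendsto_of_forall_mem_submonoid {E : Type*} [TopologicalSpace E] [CompactSpace E]
    [MeasurableSpace E] [OpensMeasurableSpace E] (S : Submonoid C(E, ℝ))
    (hS : ∀ x y, x ≠ y → ∃ f ∈ S, f x ≠ f y) {ν : ℕ → ProbabilityMeasure E}
    {ν' : ProbabilityMeasure E}
    (h : ∀ f ∈ S, Tendsto (fun n => ∫ x, f x ∂(ν n : Measure E)) atTop
      (𝓝 (∫ x, f x ∂(ν' : Measure E)))) :
    Tendsto ν atTop (𝓝 ν') := by
  have hint : ∀ (f : C(E, ℝ)) (m : ProbabilityMeasure E), Integrable f (m : Measure E) :=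
    fun f m => Integrable.of_bound f.continuous.measurable.aestronglyMeasurable ‖f‖
      (ae_of_all _ f.norm_coe_le_norm)
  have hA : ∀ f ∈ Algebra.adjoin ℝ (S : Set C(E, ℝ)),
      Tendsto (fun n => ∫ x, f x ∂(ν n : Measure E)) atTop (𝓝 (∫ x, f x ∂(ν' : Measure E))) := by
    intro f hf
    -- The algebra generated by a submonoid is its linear span, so linearity of the integral
    -- suffices.
    rw [← Subalgebra.mem_toSubmodule, Algebra.adjoin_eq_span, Submonoid.closure_eq] at hf
    induction hf using Submodule.span_induction with
    | mem f hf => exact h f hf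
    | zero => simp
    | add f g _ _ ihf ihg =>
      simp only [ContinuousMap.add_apply]
      simp only [integral_add (hint f _) (hint g _)]
      exact ihf.add ihg
    | smul a f _ ih =>
      simp only [ContinuousMap.smul_apply, integral_smul]
      exact ih.const_smul a
  have hsep : (Algebra.adjoin ℝ (S : Set C(E, ℝ))).SeparatesPoints := fun x y hxy => by
    obtain ⟨f, hf, hne⟩ := hS x y hxy
    exact ⟨f, ⟨f, Algebra.subset_adjoin hf, rfl⟩, hne⟩
  rw [ProbabilityMeasure.tendsto_iff_forall_integral_tendsto]
  intro f
  rw [Metric.tendsto_atTop']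
  intro ε hε
  -- Stone–Weierstrass. The uniform error `ε / 3` enters once for `ν n` and once for `ν'`.
  obtain ⟨⟨g, hg⟩, hgf⟩ := ContinuousMap.exists_mem_subalgebra_near_continuousMap_of_separatesPoints
    _ hsep f.toContinuousMap (ε / 3) (by positivity)
  obtain ⟨n₀, hn₀⟩ := (Metric.tendsto_atTop'.1 (hA g hg)) (ε / 3) (by positivity)
  have hclose : ∀ m : ProbabilityMeasure E,
      |∫ x, f x ∂(m : Measure E) - ∫ x, g x ∂(m : Measure E)| ≤ ε / 3 := fun m => by
    have hf : Integrable f (m : Measure E) := hint f.toContinuousMap m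
    rw [← integral_sub hf (hint g m)]
    have := norm_integral_le_of_norm_le_const (μ := (m : Measure E))
      (f := fun x => f x - g x) (C := ε / 3) (ae_of_all _ fun x => by
        have h1 := (g - f.toContinuousMap).norm_coe_le_norm x
        rw [← norm_neg]
        simpa using h1.trans hgf.le)
    simpa using this
  refine ⟨n₀, fun n hn => ?_⟩
  have h1 := hn₀ n hn
  rw [Real.dist_eq] at h1 ⊢
  have h2 := hclose (ν n)
  have h3 := hclose ν'
  rw [abs_lt] at h1 ⊢
  rw [abs_le] at h2 h3
  constructor <;> linarith

/-! ### The function `exp (-x)` on `[0, ∞]` -/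

/-- The function `exp (-x)` on `[0, ∞]`. -/
noncomputable def expNeg (x : ℝ≥0∞) : ℝ := ((EReal.exp x)⁻¹).toReal

theorem expNeg_inv_ne_top (x : ℝ≥0∞) : (EReal.exp x)⁻¹ ≠ ∞ := by
  rw [ENNReal.inv_ne_top]
  simp

theorem continuous_expNeg : Continuous expNeg :=
  ENNReal.continuousOn_toReal.comp_continuous
    (ENNReal.continuous_exp.comp continuous_coe_ennreal_ereal).inv expNeg_inv_ne_top

/-- Injectivity includes the point `∞`, so the coordinates of `expNeg` separate points of the
compact `[0, ∞]^k` and no tightness argument is needed. -/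
theorem expNeg_injective : Function.Injective expNeg := fun x y h => by
  have := (ENNReal.toReal_eq_toReal_iff' (expNeg_inv_ne_top x) (expNeg_inv_ne_top y)).1 h
  have := EReal.exp_strictMono.injective (inv_injective this)
  exact_mod_cast this

theorem expNeg_add (x y : ℝ≥0∞) : expNeg (x + y) = expNeg x * expNeg y := by
  rw [expNeg, EReal.coe_ennreal_add, EReal.exp_add, ENNReal.mul_inv, ENNReal.toReal_mul]
  · rfl
  · left; simp
  · right; simp

theorem expNeg_zero : expNeg 0 = 1 := by simp [expNeg]

theorem expNeg_natCast (n : ℕ) : expNeg n = Real.exp (-n) := by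
  have : ((n : ℝ≥0∞) : EReal) = ((n : ℝ) : EReal) := rfl
  rw [expNeg, this, EReal.exp_coe, ENNReal.toReal_inv, ENNReal.toReal_ofReal (Real.exp_pos _).le,
    Real.exp_neg]

theorem expNeg_sum {ι : Type*} (s : Finset ι) (f : ι → ℝ≥0∞) :
    expNeg (∑ i ∈ s, f i) = ∏ i ∈ s, expNeg (f i) := by
  classical
  induction s using Finset.induction_on with
  | empty => simp [expNeg_zero]
  | insert a s ha ih => rw [Finset.sum_insert ha, Finset.prod_insert ha, expNeg_add, ih]

/-- Convergence in distribution of vectors in `[0, ∞]^k` follows from convergence of their Laplace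
transforms. -/
theorem tendstoInDistribution_of_expNeg {Ω Ω' : Type*} [MeasurableSpace Ω] [MeasurableSpace Ω']
    {P : Measure Ω} [IsProbabilityMeasure P] {Q : Measure Ω'} [IsProbabilityMeasure Q] {k : ℕ}
    {V : ℕ → Ω → Fin k → ℝ≥0∞} {W : Ω' → Fin k → ℝ≥0∞} (hV : ∀ n, Measurable (V n))
    (hW : Measurable W)
    (h : ∀ a : Fin k → ℕ, Tendsto (fun n => ∫ ω, ∏ j, expNeg (V n ω j) ^ a j ∂P) atTop
      (𝓝 (∫ ω, ∏ j, expNeg (W ω j) ^ a j ∂Q))) :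
    TendstoInDistribution V atTop W (fun _ => P) Q where
  forall_aemeasurable n := (hV n).aemeasurable
  aemeasurable_limit := hW.aemeasurable
  tendsto := by
    set mon : (Fin k → ℕ) → C(Fin k → ℝ≥0∞, ℝ) := fun a =>
      ⟨fun x => ∏ j, expNeg (x j) ^ a j,
        continuous_finsetProd _ fun j _ => (continuous_expNeg.comp (continuous_apply j)).pow _⟩
      with hmon
    let S : Submonoid C(Fin k → ℝ≥0∞, ℝ) :=
      { carrier := Set.range mon
        one_mem' := ⟨0, by ext; simp [hmon]⟩
        mul_mem' := by
          rintro _ _ ⟨a, rfl⟩ ⟨b, rfl⟩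
          exact ⟨a + b, by ext; simp [hmon, pow_add, Finset.prod_mul_distrib]⟩ }
    refine tendsto_of_forall_mem_submonoid S (fun x y hxy => ?_) ?_
    · obtain ⟨j, hj⟩ := Function.ne_iff.1 hxy
      refine ⟨mon (Pi.single j 1), ⟨_, rfl⟩, ?_⟩
      have : ∀ z : Fin k → ℝ≥0∞, mon (Pi.single j 1) z = expNeg (z j) := fun z => by
        simp only [hmon, ContinuousMap.coe_mk]
        rw [Finset.prod_eq_single j]
        · simp
        · intro i _ hij; simp [hij]
        · simp
      rw [this, this]
      exact fun h => hj (expNeg_injective h)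
    · rintro _ ⟨a, rfl⟩
      have := h a
      simp only [ProbabilityMeasure.coe_mk]
      rw [integral_map hW.aemeasurable (mon a).continuous.measurable.aestronglyMeasurable]
      simp only [integral_map (hV _).aemeasurable
        (mon a).continuous.measurable.aestronglyMeasurable]
      exact this

/-! ### Riemann sums -/

theorem intervalIntegrable_of_abs_le {g : ℝ → ℝ} (hg : Measurable g) {b : ℝ}
    (hb : ∀ x, |g x| ≤ b) (x y : ℝ) : IntervalIntegrable g volume x y :=
  (intervalIntegrable_const (c := b)).mono_fun hg.aestronglyMeasurable
    (ae_of_all _ fun x => (hb x).trans (le_abs_self b))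

theorem integral_floor_eq_sum {g : ℝ → ℝ} (hg : Measurable g) {b : ℝ} (hb : ∀ x, |g x| ≤ b)
    {δ : ℝ} (hδ : 0 < δ) (L : ℕ) :
    ∫ x in (0 : ℝ)..(L * δ), g (⌊x / δ⌋₊ * δ) = δ * ∑ i ∈ Finset.range L, g (i * δ) := by
  have hm : Measurable fun x : ℝ => g (⌊x / δ⌋₊ * δ) := by fun_prop
  have h := intervalIntegral.sum_integral_adjacent_intervals (μ := volume)
    (f := fun x : ℝ => g (⌊x / δ⌋₊ * δ)) (a := fun i : ℕ => i * δ) (n := L)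
    fun k _ => intervalIntegrable_of_abs_le hm (fun x => hb _) _ _
  simp only [Nat.cast_zero, zero_mul] at h
  rw [← h, Finset.mul_sum]
  refine Finset.sum_congr rfl fun i _ => ?_
  have hcongr : ∫ x in ((i : ℝ) * δ)..((i + 1 : ℕ) * δ), g (⌊x / δ⌋₊ * δ) =
      ∫ _ in ((i : ℝ) * δ)..((i + 1 : ℕ) * δ), g (i * δ) := by
    refine intervalIntegral.integral_congr_ae ?_
    filter_upwards [compl_mem_ae_iff.2 (measure_singleton (((i + 1 : ℕ) : ℝ) * δ))] with x hx hxi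
    rw [uIoc_of_le (by push_cast; nlinarith)] at hxi
    have hlt : x < ((i + 1 : ℕ) : ℝ) * δ := lt_of_le_of_ne hxi.2 hx
    have : ⌊x / δ⌋₊ = i := by
      rw [Nat.floor_eq_iff (div_nonneg (le_trans (by positivity) hxi.1.le) hδ.le),
        le_div_iff₀ hδ, div_lt_iff₀ hδ]
      exact ⟨hxi.1.le, by push_cast at hlt; exact hlt⟩
    rw [this]
  rw [hcongr, intervalIntegral.integral_const, smul_eq_mul]
  push_cast
  ring

/-- The sum is the integral of the step function `x ↦ g (⌊x / δ⌋₊ * δ)`, which converges at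
continuity points of `g`; dominated convergence applies. -/
theorem tendsto_mul_sum_integral {g : ℝ → ℝ} (hg : Measurable g) {b : ℝ} (hb : ∀ x, |g x| ≤ b)
    {K : ℝ} (hK0 : 0 ≤ K) (hK : ∀ x, K ≤ x → g x = 0) (hc : ∀ᵐ x : ℝ, ContinuousAt g x)
    {δ : ℕ → ℝ} (hδ0 : ∀ᶠ n in atTop, 0 < δ n) (hδ : Tendsto δ atTop (𝓝 0)) {L : ℕ → ℕ}
    (hL : ∀ᶠ n in atTop, K + 1 ≤ L n * δ n) :
    Tendsto (fun n => δ n * ∑ i ∈ Finset.range (L n), g (i * δ n)) atTop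
      (𝓝 (∫ x in (0 : ℝ)..(K + 1), g x)) := by
  have hm : ∀ d : ℝ, Measurable fun x : ℝ => g (⌊x / d⌋₊ * d) := fun d => by fun_prop
  have hfloor : ∀ {x d : ℝ}, 0 ≤ x → 0 < d → x - d ≤ ⌊x / d⌋₊ * d ∧ ⌊x / d⌋₊ * d ≤ x := by
    intro x d hx hd
    have h1 := Nat.floor_le (div_nonneg hx hd.le)
    have h2 := (Nat.lt_floor_add_one (x / d)).le
    rw [le_div_iff₀ hd] at h1
    rw [div_le_iff₀ hd] at h2
    exact ⟨by linarith, h1⟩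
  have h1 : Tendsto (fun n => ∫ x in (0 : ℝ)..(K + 1), g (⌊x / δ n⌋₊ * δ n)) atTop
      (𝓝 (∫ x in (0 : ℝ)..(K + 1), g x)) := by
    refine intervalIntegral.tendsto_integral_filter_of_dominated_convergence (fun _ => b)
      (Eventually.of_forall fun n => (hm _).aestronglyMeasurable)
      (Eventually.of_forall fun n => ae_of_all _ fun x _ => hb _) intervalIntegrable_const ?_
    filter_upwards [hc] with x hx hxi
    rw [uIoc_of_le (by linarith)] at hxi
    refine hx.tendsto.comp ?_
    refine tendsto_of_tendsto_of_tendsto_of_le_of_le' (g := fun n => x - δ n) (h := fun _ => x)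
      (by simpa using tendsto_const_nhds.sub hδ) tendsto_const_nhds ?_ ?_
    · filter_upwards [hδ0] with n hn using (hfloor hxi.1.le hn).1
    · filter_upwards [hδ0] with n hn using (hfloor hxi.1.le hn).2
  refine h1.congr' ?_
  filter_upwards [hδ0, hδ.eventually (gt_mem_nhds one_pos), hL] with n hn hn1 hLn
  rw [← integral_floor_eq_sum hg hb hn, ← intervalIntegral.integral_add_adjacent_intervals
    (intervalIntegrable_of_abs_le (hm _) (fun x => hb _) 0 (K + 1))
    (intervalIntegrable_of_abs_le (hm _) (fun x => hb _) (K + 1) (L n * δ n))]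
  -- The margin `1 > δ n` keeps the grid point below `x` at or beyond `K`, where `g` vanishes.
  have : ∫ x in (K + 1)..(L n * δ n), g (⌊x / δ n⌋₊ * δ n) = 0 := by
    refine intervalIntegral.integral_zero_ae (ae_of_all _ fun x hx => hK _ ?_)
    rw [uIoc_of_le hLn] at hx
    linarith [(hfloor (by linarith [hx.1] : 0 ≤ x) hn).1, hx.1]
  rw [this, add_zero]

/-! ### Weights of points relative to sets of the ring -/

theorem InRing.measurableSet {A : Set ℝ} (hA : InRing A) : MeasurableSet A := by
  obtain ⟨s, -, rfl⟩ := hA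
  exact Finset.measurableSet_biUnion _ fun I _ => measurableSet_Ico

/-- Membership can change only at the finitely many endpoints. -/
theorem InRing.ae_eventually_mem_iff {A : Set ℝ} (hA : InRing A) :
    ∀ᵐ x : ℝ, ∀ᶠ y in 𝓝 x, (y ∈ A ↔ x ∈ A) := by
  obtain ⟨s, -, rfl⟩ := hA
  have h : ∀ᵐ x : ℝ, ∀ I ∈ s, x ≠ I.1 ∧ x ≠ I.2 := by
    refine (eventually_all_finset s).2 fun I _ => ?_
    filter_upwards [compl_mem_ae_iff.2 (measure_singleton I.1),
      compl_mem_ae_iff.2 (measure_singleton I.2)] with x h1 h2 using ⟨h1, h2⟩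
  filter_upwards [h] with x hx
  have : ∀ᶠ y in 𝓝 x, ∀ I ∈ s, (y ∈ Set.Ico I.1 I.2 ↔ x ∈ Set.Ico I.1 I.2) := by
    rw [eventually_all_finset]
    intro I hI
    have h1 : ∀ᶠ y in 𝓝 x, (I.1 ≤ y ↔ I.1 ≤ x) := by
      rcases lt_or_gt_of_ne (hx I hI).1 with h | h
      · filter_upwards [gt_mem_nhds h] with y hy
        exact ⟨fun h' => absurd hy h'.not_gt, fun h' => absurd h h'.not_gt⟩
      · filter_upwards [lt_mem_nhds h] with y hy using ⟨fun _ => h.le, fun _ => hy.le⟩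
    have h2 : ∀ᶠ y in 𝓝 x, (y < I.2 ↔ x < I.2) := by
      rcases lt_or_gt_of_ne (hx I hI).2 with h | h
      · filter_upwards [gt_mem_nhds h] with y hy using ⟨fun _ => h, fun _ => hy⟩
      · filter_upwards [lt_mem_nhds h] with y hy
        exact ⟨fun h' => absurd hy h'.not_gt, fun h' => absurd h h'.not_gt⟩
    filter_upwards [h1, h2] with y h1 h2
    rw [mem_Ico, mem_Ico, h1, h2]
  filter_upwards [this] with y hy
  simp only [mem_iUnion]
  exact exists_congr fun I => exists_congr fun hI => hy I hI

open Classical in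
/-- The sum of the `a j` over the sets `J j` that contain `x`. -/
noncomputable def ringWeight {k : ℕ} (J : Fin k → Set ℝ) (a : Fin k → ℕ) (x : ℝ) : ℕ :=
  ∑ j, if x ∈ J j then a j else 0

/-- The integrand of the exponent of the Laplace transform of a Poisson process. -/
noncomputable def laplaceRate {k : ℕ} (J : Fin k → Set ℝ) (a : Fin k → ℕ) (x : ℝ) : ℝ :=
  1 - Real.exp (-ringWeight J a x)

section weights

variable {k : ℕ} {J : Fin k → Set ℝ} {a : Fin k → ℕ}

theorem laplaceRate_nonneg (x : ℝ) : 0 ≤ laplaceRate J a x :=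
  sub_nonneg.2 (Real.exp_le_one_iff.2 (neg_nonpos.2 (Nat.cast_nonneg _)))

theorem laplaceRate_le_one (x : ℝ) : laplaceRate J a x ≤ 1 :=
  sub_le_self _ (Real.exp_pos _).le

theorem abs_laplaceRate_le (x : ℝ) : |laplaceRate J a x| ≤ 1 := by
  rw [abs_of_nonneg (laplaceRate_nonneg x)]
  exact laplaceRate_le_one x

theorem measurable_laplaceRate (hJ : ∀ j, MeasurableSet (J j)) :
    Measurable (laplaceRate J a) := by
  have : Measurable (ringWeight J a) := by
    unfold ringWeight
    exact Finset.measurable_sum _ fun j _ =>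
      Measurable.ite (hJ j) measurable_const measurable_const
  unfold laplaceRate
  have h2 : Measurable fun x => (ringWeight J a x : ℝ) := measurable_from_top.comp this
  exact measurable_const.sub (Real.measurable_exp.comp h2.neg)

theorem laplaceRate_eq_zero {x : ℝ} (hx : ∀ j, x ∉ J j) : laplaceRate J a x = 0 := by
  simp [laplaceRate, ringWeight, hx]

open Classical in
theorem ae_continuousAt_laplaceRate (hJ : ∀ j, InRing (J j)) :
    ∀ᵐ x : ℝ, ContinuousAt (laplaceRate J a) x := by
  filter_upwards [ae_all_iff.2 fun j => (hJ j).ae_eventually_mem_iff] with x hx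
  have : laplaceRate J a =ᶠ[𝓝 x] fun _ => laplaceRate J a x := by
    filter_upwards [eventually_all.2 hx] with y hy
    have : ringWeight J a y = ringWeight J a x :=
      Finset.sum_congr rfl fun j _ => if_congr (hy j) rfl rfl
    rw [laplaceRate, laplaceRate, this]
  exact continuousAt_const.congr this.symm

open Classical in
theorem prod_ite_exp_pow (x : ℝ) :
    ∏ j, (if x ∈ J j then Real.exp (-1) else 1) ^ a j = 1 - laplaceRate J a x := by
  rw [laplaceRate, sub_sub_cancel, ringWeight, Nat.cast_sum, ← Finset.sum_neg_distrib, Real.exp_sum]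
  refine Finset.prod_congr rfl fun j _ => ?_
  split_ifs
  · rw [← Real.exp_nat_mul]; congr 1; ring
  · simp

end weights

/-! ### The Laplace transform of a Poisson process -/

/-- The Poisson generating function at `exp (-s)`, summed by the exponential series. -/
theorem integral_expNeg_pow_poissonMeasure (r : ℝ≥0) (s : ℕ) :
    ∫ n, expNeg ((n : ℕ) : ℝ≥0∞) ^ s ∂(poissonMeasure r) =
      Real.exp (-((1 - Real.exp (-s)) * r)) := by
  rw [integral_poissonMeasure]
  have h := (NormedSpace.expSeries_div_hasSum_exp ((r : ℝ) * Real.exp (-s))).mul_left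
    (Real.exp (-r))
  rw [← Real.exp_eq_exp_ℝ, ← Real.exp_add] at h
  rw [show -((1 - Real.exp (-(s : ℝ))) * (r : ℝ)) = -(r : ℝ) + r * Real.exp (-s) by ring, ← h.tsum_eq]
  refine tsum_congr fun n => ?_
  rw [expNeg_natCast, smul_eq_mul, mul_pow, ← Real.exp_nat_mul, ← Real.exp_nat_mul]
  rw [show (s : ℝ) * -(n : ℝ) = n * -(s : ℝ) by ring]
  ring

section poisson

variable {Ω' : Type*} [MeasurableSpace Ω'] {Q : Measure Ω'} [IsProbabilityMeasure Q]
  {N : Ω' → Measure ℝ}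

theorem IsPoissonProcess.measurable_apply (hN : IsPoissonProcess Q N) {B : Set ℝ}
    (hB : MeasurableSet B) : Measurable fun ω => N ω B :=
  (Measure.measurable_coe hB).comp hN.measurable

theorem IsPoissonProcess.integral_expNeg_pow (hN : IsPoissonProcess Q N) {B : Set ℝ}
    (hB : MeasurableSet B) (hB0 : B ⊆ Set.Ici 0) (hBt : volume B ≠ ∞) (s : ℕ) :
    ∫ ω, expNeg (N ω B) ^ s ∂Q = Real.exp (-((1 - Real.exp (-s)) * volume.real B)) := by
  have hm : Measurable fun x => expNeg x ^ s := (continuous_expNeg.pow s).measurable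
  have h := integral_map (μ := Q) (hN.measurable_apply hB).aemeasurable
    (f := fun x => expNeg x ^ s) hm.aestronglyMeasurable
  rw [← h, hN.law B hB hB0 hBt, integral_map (by fun_prop) hm.aestronglyMeasurable,
    integral_expNeg_pow_poissonMeasure]
  rfl

/-- The `J j` may overlap, so they are split into the disjoint atoms `B S` of points lying in
exactly the `J j` with `j ∈ S`. The masses of atoms are independent, and `laplaceRate` is constant
on each atom. -/
theorem IsPoissonProcess.integral_prod_expNeg (hN : IsPoissonProcess Q N) {k : ℕ}
    {J : Fin k → Set ℝ} (hJ : ∀ j, InRing (J j)) (a : Fin k → ℕ) {K : ℝ} (hK0 : 0 ≤ K)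
    (hK : ∀ j, ∀ x ∈ J j, x < K) :
    ∫ ω, ∏ j, expNeg (N ω (J j)) ^ a j ∂Q =
      Real.exp (-∫ x in (0 : ℝ)..K, laplaceRate J a x) := by
  classical
  set B : Finset (Fin k) → Set ℝ := fun S => {x | x ∈ Set.Ico 0 K ∧ ∀ j, x ∈ J j ↔ j ∈ S} with hBdef
  have hJm : ∀ j, MeasurableSet (J j) := fun j => (hJ j).measurableSet
  have hBm : ∀ S, MeasurableSet (B S) := fun S => by
    have : B S = Set.Ico 0 K ∩ ⋂ j, if j ∈ S then J j else (J j)ᶜ := by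
      ext x
      simp only [hBdef, Set.mem_ofPred_eq, mem_inter_iff, mem_iInter]
      refine and_congr Iff.rfl (forall_congr' fun j => ?_)
      split_ifs with h <;> simp [h]
    rw [this]
    refine measurableSet_Ico.inter (MeasurableSet.iInter fun j => ?_)
    split_ifs
    exacts [hJm j, (hJm j).compl]
  have hBK : ∀ S, B S ⊆ Set.Ico 0 K := fun S x hx => hx.1
  have hB0 : ∀ S, B S ⊆ Set.Ici 0 := fun S x hx => hx.1.1
  have hBt : ∀ S, volume (B S) ≠ ∞ := fun S =>
    ((measure_mono (hBK S)).trans_lt measure_Ico_lt_top).ne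
  have hdisj : Pairwise fun S T => Disjoint (B S) (B T) := fun S T hST => by
    refine Set.disjoint_left.2 fun x hx hx' => ?_
    exact hST (Finset.ext fun j => (hx.2 j).symm.trans (hx'.2 j))
  have hmem : ∀ x ∈ Set.Ico 0 K, ∃ S, x ∈ B S := fun x hx =>
    ⟨Finset.univ.filter fun j => x ∈ J j, hx, fun j => by simp⟩
  have hJB : ∀ j, J j = ⋃ S ∈ Finset.univ.filter (fun S => j ∈ S), B S := fun j => by
    ext x
    simp only [mem_iUnion, Finset.mem_filter, Finset.mem_univ, true_and, exists_prop]
    constructor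
    · intro hx
      obtain ⟨S, hS⟩ := hmem x ⟨(hJ j).nonneg hx, hK j x hx⟩
      exact ⟨S, (hS.2 j).1 hx, hS⟩
    · rintro ⟨S, hjS, hS⟩
      exact (hS.2 j).2 hjS
  have hNJ : ∀ ω j, N ω (J j) = ∑ S ∈ Finset.univ.filter (fun S => j ∈ S), N ω (B S) := fun ω j => by
    rw [hJB j, measure_biUnion_finset (fun S _ T _ hST => hdisj hST) fun S _ => hBm S]
  set wt : Finset (Fin k) → ℕ := fun S => ∑ j ∈ S, a j with hwt
  have hprod : ∀ ω, ∏ j, expNeg (N ω (J j)) ^ a j = ∏ S, expNeg (N ω (B S)) ^ wt S := fun ω => by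
    simp only [hNJ, expNeg_sum, ← Finset.prod_pow, Finset.prod_filter]
    rw [Finset.prod_comm]
    refine Finset.prod_congr rfl fun S _ => ?_
    rw [hwt, ← Finset.prod_pow_eq_pow_sum]
    simp only [ite_pow, one_pow]
    rw [← Finset.prod_filter]
    exact Finset.prod_congr (by ext; simp) fun _ _ => rfl
  have hindep : iIndepFun (fun S ω => N ω (B S)) Q := by
    set e := Fintype.equivFin (Finset (Fin k))
    have := hN.indep _ (fun i => B (e.symm i)) (fun i => hBm _) (fun i => hB0 _)
      fun i j hij => hdisj fun h => hij (e.symm.injective h)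
    have h2 := this.precomp e.injective
    convert h2 using 2 with S
    simp
  have hind2 : iIndepFun (fun S ω => expNeg (N ω (B S)) ^ wt S) Q :=
    hindep.comp (fun S x => expNeg x ^ wt S) fun S => (continuous_expNeg.pow _).measurable
  simp only [hprod]
  rw [hind2.integral_fun_prod_eq_prod_integral fun S =>
    ((continuous_expNeg.pow _).measurable.comp (hN.measurable_apply (hBm S))).aestronglyMeasurable]
  simp only [hN.integral_expNeg_pow (hBm _) (hB0 _) (hBt _)]
  rw [← Real.exp_sum, Finset.sum_neg_distrib]
  congr 2
  have hrate : ∀ x ∈ Set.Ico 0 K,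
      laplaceRate J a x = ∑ S, (B S).indicator (fun _ => 1 - Real.exp (-(wt S : ℝ))) x := by
    intro x hx
    obtain ⟨S, hS⟩ := hmem x hx
    rw [Finset.sum_eq_single S, indicator_of_mem hS]
    · simp only [laplaceRate, ringWeight, hS.2, hwt]
      rw [← Finset.sum_filter]
      simp
    · intro T _ hTS
      exact indicator_of_notMem (fun hT => Set.disjoint_left.1 (hdisj hTS) hT hS) _
    · simp
  rw [intervalIntegral.integral_of_le hK0, ← integral_Ico_eq_integral_Ioc,
    setIntegral_congr_fun measurableSet_Ico hrate, integral_finsetSum]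
  · refine Finset.sum_congr rfl fun S _ => ?_
    rw [setIntegral_indicator (hBm S), inter_eq_right.2 (hBK S), setIntegral_const, smul_eq_mul,
      mul_comm]
  · intro S _
    exact (integrable_const _).indicator (hBm S)

end poisson

/-! ### Poisson limits for mixing chains -/

section chain

variable {M Ω : Type*} [MeasurableSpace M] [MeasurableSpace Ω] {P : Measure Ω}
  [IsProbabilityMeasure P] {p : Kernel M M} [IsMarkovKernel p] {μ : Measure M}
  [IsProbabilityMeasure μ] {Z : ℕ → Ω → M} {N : ℕ} {c C : ℝ}

/-- Exchanging the products over sets and over times collects, at each visit time `i`, the factor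
`exp (-ringWeight)` at the rescaled time `i * δ`, which is one minus the Laplace rate. -/
theorem prod_expNeg_exceedances {φ : M → EReal} {v δ : ℝ} (hδ : 0 < δ) {k : ℕ} {J : Fin k → Set ℝ}
    (a : Fin k → ℕ) {L : ℕ} (hL : ∀ j, ∀ x ∈ J j, x < L * δ) (ω : Ω) :
    ∏ j, expNeg (exceedances (fun n ω => φ (Z n ω)) v ((fun s => δ⁻¹ * s) '' J j) ω) ^ a j =
      visitProd Z {x | (v : EReal) < φ x} (fun i => laplaceRate J a (i * δ)) L ω := by
  classical
  have hmem : ∀ (j : Fin k) (i : ℕ), (i : ℝ) ∈ (fun s => δ⁻¹ * s) '' J j ↔ i * δ ∈ J j := by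
    intro j i
    constructor
    · rintro ⟨x, hx, hxi⟩
      have : (i : ℝ) * δ = x := by
        rw [← hxi]; field_simp
      rwa [this]
    · exact fun h => ⟨_, h, by field_simp⟩
  have hlt : ∀ (j : Fin k) (i : ℕ), (i : ℝ) ∈ (fun s => δ⁻¹ * s) '' J j → i < L := fun j i hi => by
    have := lt_of_mul_lt_mul_right (hL j _ ((hmem j i).1 hi)) hδ.le
    exact_mod_cast this
  simp only [exceedances_eq_sum (hlt _), expNeg_sum, ← Finset.prod_pow]
  rw [Finset.prod_comm, visitProd]
  refine Finset.prod_congr rfl fun i _ => ?_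
  by_cases hi : (v : EReal) < φ (Z i ω)
  · rw [indicator_of_mem (by exact hi), Pi.one_apply, mul_one, ← prod_ite_exp_pow]
    refine Finset.prod_congr rfl fun j _ => ?_
    simp only [indicator, Set.mem_ofPred_eq, hmem, hi, and_true]
    split_ifs
    · rw [Pi.one_apply, ← Nat.cast_one, expNeg_natCast, Nat.cast_one]
    · rw [expNeg_zero]
  · rw [indicator_of_notMem (by exact hi), mul_zero, sub_zero]
    refine Finset.prod_eq_one fun j _ => ?_
    simp [indicator, hi, expNeg_zero]

namespace IsMixingChain

theorem convergesInDistribution (hZ : IsMixingChain P p μ Z N c C) {φ : M → EReal}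
    (hφ : Measurable φ) {u : ℕ → ℝ} {τ : ℝ} (hτ : 0 < τ)
    (hu : Tendsto (fun n : ℕ => (n : ℝ) * μ.real {x | (u n : EReal) < φ x}) atTop (𝓝 τ))
    {Ω' : Type*} [MeasurableSpace Ω'] {Q : Measure Ω'} [IsProbabilityMeasure Q]
    {N' : Ω' → Measure ℝ} (hN : IsPoissonProcess Q N') :
    ConvergesInDistribution P (repp P (fun n ω => φ (Z n ω)) u) Q N' := by
  intro k J hJ
  have hU : ∀ n, MeasurableSet {x | (u n : EReal) < φ x} := fun n =>
    measurableSet_lt measurable_const hφ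
  have hmX : ∀ n, Measurable fun ω => φ (Z n ω) := fun n => hφ.comp (hZ.chain.measurable n)
  refine tendstoInDistribution_of_expNeg
    (fun n => measurable_pi_lambda _ fun j => measurable_exceedances hmX)
    (measurable_pi_lambda _ fun j => hN.measurable_apply (hJ j).measurableSet) fun a => ?_
  choose Kj hKj using fun j => (hJ j).exists_lt
  set K : ℝ := ∑ j, (Kj j : ℝ) with hKdef
  have hK0 : 0 ≤ K := Finset.sum_nonneg fun j _ => Nat.cast_nonneg _
  have hK : ∀ j, ∀ x ∈ J j, x < K := fun j x hx => (hKj j x hx).trans_le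
    (Finset.single_le_sum (f := fun j => (Kj j : ℝ)) (fun i _ => Nat.cast_nonneg _)
      (Finset.mem_univ j))
  rw [hN.integral_prod_expNeg hJ a (K := K + 1) (by linarith)
    fun j x hx => (hK j x hx).trans (by linarith)]
  set δ : ℕ → ℝ := fun n => μ.real {x | (u n : EReal) < φ x} with hδdef
  have hδt : Tendsto δ atTop (𝓝 0) := by
    have h := hu.mul (tendsto_const_div_atTop_nhds_zero_nat 1)
    rw [mul_zero] at h
    refine h.congr' ?_
    filter_upwards [eventually_ge_atTop 1] with n hn
    have : (n : ℝ) ≠ 0 := by positivity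
    simp only [hδdef]
    field_simp
  have hδ0 : ∀ᶠ n in atTop, 0 < δ n := by
    filter_upwards [hu.eventually (lt_mem_nhds hτ)] with n hn
    exact pos_of_mul_pos_right hn (Nat.cast_nonneg _)
  -- Enough times to cover all rescaled sets, while `L n * δ n` stays bounded by `K + 2`.
  set L : ℕ → ℕ := fun n => ⌈(K + 1) / δ n⌉₊ with hLdef
  have hL1 : ∀ᶠ n in atTop, K + 1 ≤ L n * δ n := by
    filter_upwards [hδ0] with n hn
    rw [← div_le_iff₀ hn]
    exact Nat.le_ceil _
  have hL2 : ∀ᶠ n in atTop, L n * δ n ≤ K + 2 := by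
    filter_upwards [hδ0, hδt.eventually (gt_mem_nhds one_pos)] with n hn hn1
    have := (Nat.ceil_lt_add_one (div_nonneg (by linarith : (0 : ℝ) ≤ K + 1) hn.le)).le
    have := mul_le_mul_of_nonneg_right this hn.le
    rw [add_mul, div_mul_cancel₀ _ hn.ne'] at this
    linarith
  have hlim := hZ.tendsto_integral_visitProd hU hδt hL2
    (w := fun n i => laplaceRate J a (i * δ n)) (fun n i => laplaceRate_nonneg _)
    (fun n i => laplaceRate_le_one _)
    (tendsto_mul_sum_integral (measurable_laplaceRate fun j => (hJ j).measurableSet)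
      abs_laplaceRate_le hK0 (fun x hx => laplaceRate_eq_zero fun j hj => (hK j x hj).not_ge hx)
      (ae_continuousAt_laplaceRate hJ) hδ0 hδt hL1)
  refine hlim.congr' ?_
  filter_upwards [hδ0, hL1] with n hn hLn
  congr 1
  ext ω
  rw [← prod_expNeg_exceedances hn a
    (fun j x hx => (hK j x hx).trans_le (by linarith)) ω]
  have : P.real {ω | (u n : EReal) < φ (Z 0 ω)} = δ n := hZ.real_preimage (hU n) 0
  simp only [repp, this]

theorem hasPoissonRareEvents.{r, s} {M : Type*} {Ω : Type s} [MeasurableSpace M]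
    [MeasurableSpace Ω] {P : Measure Ω} [IsProbabilityMeasure P] {p : Kernel M M}
    [IsMarkovKernel p] {μ : Measure M} [IsProbabilityMeasure μ] {Z : ℕ → Ω → M}
    (hZ : IsMixingChain P p μ Z N c C) {φ : M → EReal} (hφ : Measurable φ) {u : ℕ → ℝ} {τ : ℝ}
    (hτ : 0 < τ)
    (hu : Tendsto (fun n : ℕ => (n : ℝ) * μ.real {x | (u n : EReal) < φ x}) atTop (𝓝 τ)) :
    HasPoissonRareEvents.{r} P (fun n ω => φ (Z n ω)) u :=
  ⟨hZ.exists_condD3 hφ hu, fun _ => hZ.condD' hφ hu,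
    fun _ _ _ _ _ hN => hZ.convergesInDistribution hφ hτ hu hN⟩

end IsMixingChain
end chain

/-! ### Pseudo-orbits along a dense sequence -/

section pseudoOrbit

variable {M : Type*} [MetricSpace M] (x : ℕ → M) (r : ℝ)

/-- There is an `r`-pseudo-orbit of length `n` from `x i` to `x j`, for the map `x i ↦ x (i + 1)`. -/
def Reach : ℕ → ℕ → ℕ → Prop
  | 0, i, j => i = j
  | n + 1, i, j => ∃ k, dist (x (i + 1)) (x k) < r ∧ Reach n k j

variable {x r}

theorem Reach.trans {m n i j k : ℕ} (h : Reach x r m i j) (h' : Reach x r n j k) :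
    Reach x r (m + n) i k := by
  induction m generalizing i with
  | zero => obtain rfl : i = j := h; rwa [zero_add]
  | succ m ih =>
    obtain ⟨l, hl, h⟩ := h
    rw [add_right_comm]
    exact ⟨l, hl, ih h⟩

theorem Reach.of_dist {i j : ℕ} (h : dist (x (i + 1)) (x j) < r) : Reach x r 1 i j := ⟨j, h, rfl⟩

variable (hr : 0 < r)

include hr

theorem reach_add (n i : ℕ) : Reach x r n i (i + n) := by
  induction n generalizing i with
  | zero => rfl
  | succ n ih =>
    refine ⟨i + 1, by simpa using hr, ?_⟩
    have := ih (i + 1)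
    rwa [add_assoc, add_comm 1 n] at this

/-- The orbit is followed from `i` to `m - 1`; the last jump lands on `x j` instead of `x m`. -/
theorem reach_of_dist {i j m : ℕ} (hm : i < m) (h : dist (x m) (x j) < r) :
    Reach x r (m - i) i j := by
  obtain ⟨n, rfl⟩ : ∃ n, m = i + n + 1 := ⟨m - i - 1, by omega⟩
  rw [show i + n + 1 - i = n + 1 by omega]
  exact (reach_add hr n i).trans (.of_dist h)

variable [ConnectedSpace M] (hx : DenseRange x)

include hx

/-- A nontrivial connected metric space has no isolated points, so the orbit stays dense after
deleting its first points. -/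
theorem exists_gt_dist_lt (i : ℕ) (y : M) : ∃ m, i < m ∧ dist (x m) y < r := by
  rcases subsingleton_or_nontrivial M with h | h
  · exact ⟨i + 1, by omega, by rwa [Subsingleton.elim (x (i + 1)) y, dist_self]⟩
  · have hd : Dense (Set.range x \ (x '' Set.Iic i)) := Dense.sdiff_finite hx ((finite_Iic i).image x)
    obtain ⟨_, ⟨⟨m, rfl⟩, hm⟩, hz⟩ :=
      hd.exists_mem_open Metric.isOpen_ball ⟨y, Metric.mem_ball_self hr⟩
    refine ⟨m, ?_, hz⟩
    by_contra hmi
    exact hm ⟨m, not_lt.1 hmi, rfl⟩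

theorem exists_reach (i j : ℕ) : ∃ n, Reach x r n i j := by
  obtain ⟨m, hm, h⟩ := exists_gt_dist_lt hr hx i (x j)
  exact ⟨_, reach_of_dist hr hm h⟩

/-- If `x a` and `x b` are close, a path of length `l` from `b` to `0` closes up to loops of lengths
`a + l` and `b + l`, so the period `g` divides both `a` and `b` or neither. Neighbourhoods of the
points with index divisible by `g`, and of the others, then partition `M` into open sets; by
connectedness the second is empty. As `x 1` is not in it, `g = 1`. -/
theorem setGcd_reach : Nat.setGcd {n | Reach x r n 0 0} = 1 := by
  set S : Set ℕ := {n | Reach x r n 0 0}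
  set g := Nat.setGcd S
  have hS : ∀ n, Reach x r n 0 0 → g ∣ n := fun n hn => Nat.setGcd_dvd_of_mem hn
  have key : ∀ a b, 0 < a → dist (x a) (x b) < r → (g ∣ a ↔ g ∣ b) := by
    intro a b ha h
    obtain ⟨l, hl⟩ := exists_reach hr hx b 0
    have h1 := hS _ ((reach_of_dist hr ha h).trans hl)
    have h2 : g ∣ b + l := by
      have := (reach_add (x := x) hr b 0).trans (by rwa [zero_add])
      exact hS _ this
    rw [tsub_zero] at h1
    constructor
    · intro h
      exact (Nat.dvd_add_left ((Nat.dvd_add_right h).1 h1)).1 h2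
    · intro h
      exact (Nat.dvd_add_left ((Nat.dvd_add_right h).1 h2)).1 h1
  have key' : ∀ a b, dist (x a) (x b) < r → (g ∣ a ↔ g ∣ b) := by
    intro a b h
    rcases Nat.eq_zero_or_pos a with rfl | ha
    · rcases Nat.eq_zero_or_pos b with rfl | hb
      · rfl
      · exact (key b 0 hb (by rwa [dist_comm])).symm
    · exact key a b ha h
  set V : Set M := ⋃ a ∈ {a | g ∣ a}, Metric.ball (x a) (r / 2)
  set W : Set M := ⋃ a ∈ {a | ¬ g ∣ a}, Metric.ball (x a) (r / 2)
  have hV : IsOpen V := isOpen_biUnion fun _ _ => Metric.isOpen_ball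
  have hW : IsOpen W := isOpen_biUnion fun _ _ => Metric.isOpen_ball
  have hVW : Wᶜ = V := by
    refine Set.ext fun y => ⟨fun hy => ?_, fun hy hy' => ?_⟩
    · obtain ⟨a, ha⟩ := hx.exists_mem_open Metric.isOpen_ball
        ⟨y, Metric.mem_ball_self (half_pos hr)⟩
      rw [Metric.mem_ball'] at ha
      by_cases hga : g ∣ a
      · exact mem_biUnion (show a ∈ {a | g ∣ a} from hga) ha
      · exact absurd (mem_biUnion (show a ∈ {a | ¬ g ∣ a} from hga) ha) hy
    · simp only [V, W, mem_iUnion] at hy hy'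
      obtain ⟨a, ha, hya⟩ := hy
      obtain ⟨b, hb, hyb⟩ := hy'
      rw [Metric.mem_ball'] at hya
      rw [Metric.mem_ball] at hyb
      refine hb ((key' a b ?_).1 ha)
      linarith [dist_triangle (x a) y (x b)]
  have hclopen : IsClopen V := ⟨hVW ▸ hW.isClosed_compl, hV⟩
  have huniv : V = univ := hclopen.eq_univ
    ⟨x 0, mem_biUnion (show 0 ∈ {a | g ∣ a} from dvd_zero g) (Metric.mem_ball_self (half_pos hr))⟩
  by_contra hg
  have h1 : x 1 ∈ W := mem_biUnion (show 1 ∈ {a | ¬ g ∣ a} from fun h => hg (Nat.dvd_one.1 h))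
    (Metric.mem_ball_self (half_pos hr))
  exact (hVW ▸ (huniv ▸ mem_univ (x 1) : x 1 ∈ V) : x 1 ∈ Wᶜ) h1

/-- Loop lengths at `0` form an additive monoid of gcd `1`, hence contain all large integers. -/
theorem exists_forall_reach (s : Finset ℕ) : ∃ n, ∀ i ∈ s, ∀ j ∈ s, Reach x r n i j := by
  obtain ⟨n₀, hn₀⟩ := Nat.exists_mem_closure_of_ge {n | Reach x r n 0 0}
  have hS : ∀ n ≥ n₀, Reach x r n 0 0 := by
    intro n hn
    have := hn₀ n hn (by rw [setGcd_reach hr hx]; exact one_dvd n)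
    clear hn
    induction this using AddSubmonoid.closure_induction with
    | mem _ h => exact h
    | zero => rfl
    | add _ _ _ _ h h' => exact h.trans h'
  choose l hl using fun i => exists_reach (r := r) hr hx i 0
  -- The path goes from `i` to `0` in `l i` steps, loops, then follows the orbit to `j`. The sums
  -- dominate `l i` and `j`, so the loop absorbing the difference has length at least `n₀`.
  refine ⟨∑ i ∈ s, l i + n₀ + ∑ j ∈ s, j, fun i hi j hj => ?_⟩
  have h1 : l i ≤ ∑ i ∈ s, l i := Finset.single_le_sum (fun _ _ => Nat.zero_le _) hi
  have h2 : j ≤ ∑ j ∈ s, j := Finset.single_le_sum (f := fun j => j) (fun _ _ => Nat.zero_le _) hj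
  have h3 := ((hl i).trans (hS (∑ i ∈ s, l i + n₀ + ∑ j ∈ s, j - l i - j) (by omega))).trans
    (reach_add hr j 0)
  rw [zero_add] at h3
  convert h3 using 1
  omega

end pseudoOrbit

/-! ### Doeblin's condition for perturbations of transitive maps -/

section reference

variable {M Ω : Type*} [MeasurableSpace M] [MeasurableSpace Ω] {P : Measure Ω}
  [IsProbabilityMeasure P] {p : Kernel M M} [IsMarkovKernel p] {Leb μ : Measure M}
  [IsProbabilityMeasure μ] {Z : ℕ → Ω → M}

theorem lintegral_lavg_iterate (hμ : p.Invariant μ) {g : M → ℝ≥0∞} (hg : Measurable g) (n : ℕ) :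
    ∫⁻ x, (lavg p)^[n] g x ∂μ = ∫⁻ x, g x ∂μ := by
  induction n with
  | zero => rfl
  | succ n ih =>
    rw [Function.iterate_succ_apply', ← ih]
    conv_rhs => rw [← hμ.def, Measure.lintegral_bind p.aemeasurable
      (measurable_lavg_iterate p hg n).aemeasurable]
    rfl

/-- Bounds on a kernel with respect to a reference measure give bounds with respect to an
absolutely continuous invariant measure. -/
theorem IsMarkovChain.exists_isMixingChain (hZ : IsMarkovChain P p μ Z) (hμ : p.Invariant μ)
    (hac : μ ≪ Leb) {D c : ℝ} {N : ℕ} (hN : 0 < N) (hD : 0 < D) (hc : 0 < c)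
    (hup : ∀ A, MeasurableSet A → ∀ᵐ x ∂Leb, p x A ≤ ENNReal.ofReal D * Leb A)
    (hlow : ∀ g : M → ℝ≥0∞, Measurable g →
      ∀ᵐ x ∂Leb, ENNReal.ofReal c * ∫⁻ y, g y ∂Leb ≤ (lavg p)^[N] g x) :
    ∃ c' C' : ℝ, IsMixingChain P p μ Z N c' C' := by
  have h1 : ∀ A, MeasurableSet A → μ A ≤ ENNReal.ofReal D * Leb A := fun A hA => by
    calc μ A = ∫⁻ x, p x A ∂μ := by
          conv_lhs => rw [← hμ.def, Measure.bind_apply hA p.aemeasurable]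
      _ ≤ ∫⁻ _, ENNReal.ofReal D * Leb A ∂μ := lintegral_mono_ae (hac.ae_le (hup A hA))
      _ = _ := by simp
  have h1' : μ ≤ ENNReal.ofReal D • Leb := Measure.le_iff.2 fun A hA => by simpa using h1 A hA
  have h2 : ∀ g : M → ℝ≥0∞, Measurable g →
      ENNReal.ofReal c * ∫⁻ y, g y ∂Leb ≤ ∫⁻ y, g y ∂μ := fun g hg => by
    rw [← lintegral_lavg_iterate hμ hg N]
    calc _ = ∫⁻ _, ENNReal.ofReal c * ∫⁻ y, g y ∂Leb ∂μ := by simp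
      _ ≤ _ := lintegral_mono_ae (hac.ae_le (hlow g hg))
  have hcD : ∀ a : ℝ≥0∞, ENNReal.ofReal (D / c) * (ENNReal.ofReal c * a) =
      ENNReal.ofReal D * a := fun a => by
    rw [← mul_assoc, ← ENNReal.ofReal_mul (by positivity), div_mul_cancel₀ _ hc.ne']
  have hDc : ∀ a : ℝ≥0∞, ENNReal.ofReal (c / D) * (ENNReal.ofReal D * a) =
      ENNReal.ofReal c * a := fun a => by
    rw [← mul_assoc, ← ENNReal.ofReal_mul (by positivity), div_mul_cancel₀ _ hD.ne']
  -- Integrating the hypotheses against the invariant `μ` gave `c • Leb ≤ μ ≤ D • Leb`; changing the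
  -- reference measure costs these factors.
  refine ⟨c / D, max 1 (D / c), hZ, hμ, fun g hg => ?_, fun A hA => ?_, hN, by positivity,
    le_max_left _ _⟩
  · filter_upwards [hac.ae_le (hlow g hg)] with x hx
    refine le_trans ?_ hx
    calc _ ≤ ENNReal.ofReal (c / D) * (ENNReal.ofReal D * ∫⁻ y, g y ∂Leb) := by
          gcongr
          calc _ ≤ ∫⁻ y, g y ∂(ENNReal.ofReal D • Leb) := lintegral_mono' h1' le_rfl
            _ = _ := by rw [lintegral_smul_measure, smul_eq_mul]
      _ = _ := hDc _
  · filter_upwards [hac.ae_le (hup A hA)] with x hx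
    have h3 := h2 (A.indicator 1) (measurable_one.indicator hA)
    rw [lintegral_indicator_one hA, lintegral_indicator_one hA] at h3
    calc p x A ≤ ENNReal.ofReal (D / c) * (ENNReal.ofReal c * Leb A) := by rwa [hcD]
      _ ≤ ENNReal.ofReal (max 1 (D / c)) * μ A := by
          gcongr
          exact le_max_right _ _

end reference

section transitive

variable {M : Type*} [MetricSpace M] [MeasurableSpace M] [BorelSpace M] {Leb : Measure M}
  [Leb.IsOpenPosMeasure] {f : M → M} {Y : Set M} {x₀ : M} {p : Kernel M M}
  {r : ℝ} {q : ℝ≥0∞}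

theorem mul_setLIntegral_le_lavg {x : M} {B : Set M} (h : q • Leb.restrict B ≤ p x)
    {A : Set M} (hA : A ⊆ B) (g : M → ℝ≥0∞) :
    q * ∫⁻ y in A, g y ∂Leb ≤ lavg p g x :=
  calc _ ≤ q * ∫⁻ y in B, g y ∂Leb := by gcongr
    _ = ∫⁻ y, g y ∂(q • Leb.restrict B) := by rw [lintegral_smul_measure, smul_eq_mul]
    _ ≤ _ := lintegral_mono' h le_rfl

theorem ball_subset_ball_of_dist {x y z : M} (hxy : dist x y < r) (hyz : dist y z < r) :
    Metric.ball z r ⊆ Metric.ball x (3 * r) :=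
  Metric.ball_subset_ball' (by
    have := dist_triangle z y x
    rw [dist_comm z y, dist_comm y x] at this
    linarith)

/-- By continuity at the orbit point, a small ball `B` around it is sent, up to a null set, within
`r` of the next orbit point. The `3 * r`-balls around these images contain the target ball, which
yields the constant `q * Leb B`. -/
theorem IsTransitiveOn.exists_mul_setLIntegral_le (hf : IsTransitiveOn Leb f Y x₀) (hr : 0 < r)
    (hq : q ≠ 0) (hp : ∀ᵐ x ∂Leb, q • Leb.restrict (Metric.ball (f x) (3 * r)) ≤ p x)
    {i j : ℕ} (hij : dist (f^[i + 1] x₀) (f^[j] x₀) < r) :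
    ∃ c : ℝ≥0∞, c ≠ 0 ∧ ∀ g : M → ℝ≥0∞, Measurable g →
      c * ∫⁻ y in Metric.ball (f^[j] x₀) r, g y ∂Leb ≤
        ∫⁻ y in Metric.ball (f^[i] x₀) r, lavg p g y ∂Leb := by
  obtain ⟨δ, hδ, hfδ⟩ := Metric.continuousOn_iff.1 hf.cont _ (hf.orbit_mem i) r hr
  set B := Metric.ball (f^[i] x₀) (min r δ) with hB
  refine ⟨q * Leb B, mul_ne_zero hq
    (Metric.measure_ball_pos Leb _ (lt_min hr hδ)).ne', fun g hg => ?_⟩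
  calc _ = ∫⁻ _ in B, q * ∫⁻ y in Metric.ball (f^[j] x₀) r, g y ∂Leb ∂Leb := by
        rw [setLIntegral_const]; ring
    _ ≤ ∫⁻ y in B, lavg p g y ∂Leb := by
        refine lintegral_mono_ae ((ae_restrict_iff' Metric.isOpen_ball.measurableSet).2 ?_)
        filter_upwards [hf.full, hp] with y hyY hy hyB
        refine mul_setLIntegral_le_lavg hy (ball_subset_ball_of_dist ?_ hij) g
        rw [Function.iterate_succ_apply']
        exact hfδ y hyY ((Metric.mem_ball.1 hyB).trans_le (min_le_right _ _))
    _ ≤ _ := lintegral_mono_set (Metric.ball_subset_ball (min_le_left _ _))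

theorem IsTransitiveOn.exists_mul_setLIntegral_le_iterate (hf : IsTransitiveOn Leb f Y x₀)
    (hr : 0 < r) (hq : q ≠ 0)
    (hp : ∀ᵐ x ∂Leb, q • Leb.restrict (Metric.ball (f x) (3 * r)) ≤ p x)
    {n i j : ℕ} (hij : Reach (fun n => f^[n] x₀) r n i j) :
    ∃ c : ℝ≥0∞, c ≠ 0 ∧ ∀ g : M → ℝ≥0∞, Measurable g →
      c * ∫⁻ y in Metric.ball (f^[j] x₀) r, g y ∂Leb ≤
        ∫⁻ y in Metric.ball (f^[i] x₀) r, (lavg p)^[n] g y ∂Leb := by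
  induction n generalizing i with
  | zero =>
    obtain rfl : i = j := hij
    exact ⟨1, one_ne_zero, fun g _ => by simp⟩
  | succ n ih =>
    obtain ⟨k, hk, hkj⟩ := hij
    obtain ⟨c, hc, h⟩ := ih hkj
    obtain ⟨c', hc', h'⟩ := hf.exists_mul_setLIntegral_le hr hq hp hk
    refine ⟨c' * c, mul_ne_zero hc' hc, fun g hg => ?_⟩
    rw [Function.iterate_succ_apply', mul_assoc]
    exact (mul_le_mul_right (h g hg) c').trans (h' _ (measurable_lavg_iterate p hg n))

/-- A first step from `y` charges the whole ball of the finite cover containing `f y`; `n` further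
steps carry mass from it to every ball of the cover. Summing over the cover explains the division by
its cardinality. -/
theorem IsTransitiveOn.exists_lower_bound [CompactSpace M] [ConnectedSpace M]
    (hf : IsTransitiveOn Leb f Y x₀) {ρ : ℝ} (hρ : 0 < ρ) (hq : q ≠ 0)
    (hp : ∀ᵐ x ∂Leb, q • Leb.restrict (Metric.ball (f x) ρ) ≤ p x) :
    ∃ (N : ℕ) (c : ℝ), 0 < N ∧ 0 < c ∧ ∀ g : M → ℝ≥0∞, Measurable g →
      ∀ᵐ x ∂Leb, ENNReal.ofReal c * ∫⁻ y, g y ∂Leb ≤ (lavg p)^[N] g x := by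
  obtain ⟨r, hr, rfl⟩ : ∃ r, 0 < r ∧ ρ = 3 * r := ⟨ρ / 3, by positivity, by ring⟩
  obtain ⟨s, hs⟩ := isCompact_univ.elim_finite_subcover
    (fun i : ℕ => Metric.ball (f^[i] x₀) r) (fun _ => Metric.isOpen_ball) fun y _ => by
      obtain ⟨_, ⟨n, rfl⟩, hi⟩ := hf.orbit_dense.exists_mem_open Metric.isOpen_ball
        ⟨y, Metric.mem_ball_self hr⟩
      exact mem_iUnion.2 ⟨n, Metric.mem_ball'.2 hi⟩
  obtain ⟨n, hn⟩ := exists_forall_reach (x := fun n => f^[n] x₀) hr hf.orbit_dense s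
  have hs0 : s.Nonempty := by
    obtain ⟨i, hi, -⟩ := mem_iUnion₂.1 (hs (mem_univ x₀))
    exact ⟨i, hi⟩
  have hex : ∀ a : ℕ × ℕ, ∃ c : ℝ≥0∞, c ≠ 0 ∧ (a ∈ s ×ˢ s → ∀ g : M → ℝ≥0∞, Measurable g →
      c * ∫⁻ y in Metric.ball (f^[a.2] x₀) r, g y ∂Leb ≤
        ∫⁻ y in Metric.ball (f^[a.1] x₀) r, (lavg p)^[n] g y ∂Leb) := fun a => by
    by_cases ha : a ∈ s ×ˢ s
    · rw [Finset.mem_product] at ha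
      obtain ⟨c, hc, h⟩ := hf.exists_mul_setLIntegral_le_iterate hr hq hp (hn _ ha.1 _ ha.2)
      exact ⟨c, hc, fun _ => h⟩
    · exact ⟨1, one_ne_zero, fun h => absurd h ha⟩
  choose c hc0 hc using hex
  obtain ⟨K, hK0, hK⟩ : ∃ K : ℝ≥0∞, K ≠ 0 ∧ ∀ a ∈ s ×ˢ s, K ≤ c a := by
    obtain ⟨a, -, ha⟩ := (s ×ˢ s).exists_min_image c (hs0.product hs0)
    exact ⟨c a, hc0 a, ha⟩
  have hcard : (s.card : ℝ≥0∞) ≠ 0 := by simpa using hs0.ne_empty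
  have hcard' : (s.card : ℝ≥0∞) ≠ ∞ := ENNReal.natCast_ne_top _
  set k : ℝ≥0∞ := q * (K / s.card) with hk
  have hk0 : k ≠ 0 := mul_ne_zero hq (ENNReal.div_ne_zero.2 ⟨hK0, hcard'⟩)
  -- The minimum with `1` ensures finiteness, so that the constant can be taken real.
  have hm0 : min k 1 ≠ 0 := by simp [hk0]
  have hmt : min k 1 ≠ ∞ := (min_lt_of_right_lt ENNReal.one_lt_top).ne
  refine ⟨n + 1, (min k 1).toReal, Nat.succ_pos n, ENNReal.toReal_pos hm0 hmt, fun g hg => ?_⟩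
  filter_upwards [hp] with y hy
  obtain ⟨i, his, hi⟩ := mem_iUnion₂.1 (hs (mem_univ (f y)))
  have h1 : K * ∫⁻ z, g z ∂Leb ≤
      s.card * ∫⁻ z in Metric.ball (f^[i] x₀) r, (lavg p)^[n] g z ∂Leb := by
    calc _ = K * ∫⁻ z in ⋃ j ∈ s, Metric.ball (f^[j] x₀) r, g z ∂Leb := by
          rw [univ_subset_iff.1 hs, Measure.restrict_univ]
      _ ≤ K * ∑ j ∈ s, ∫⁻ z in Metric.ball (f^[j] x₀) r, g z ∂Leb := by
          gcongr
          rw [← lintegral_finsetSum_measure]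
          refine lintegral_mono' ?_ le_rfl
          refine Measure.le_iff.2 fun A hA => ?_
          rw [Measure.restrict_apply hA, Measure.finsetSum_apply, inter_iUnion₂]
          refine (measure_biUnion_finset_le _ _).trans_eq (Finset.sum_congr rfl fun j _ => ?_)
          rw [Measure.restrict_apply hA]
      _ ≤ ∑ j ∈ s, ∫⁻ z in Metric.ball (f^[i] x₀) r, (lavg p)^[n] g z ∂Leb := by
          rw [Finset.mul_sum]
          refine Finset.sum_le_sum fun j hj => ?_
          have hij : (i, j) ∈ s ×ˢ s := Finset.mem_product.2 ⟨his, hj⟩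
          exact (mul_le_mul_left (hK _ hij) _).trans (hc _ hij g hg)
      _ = _ := by rw [Finset.sum_const, nsmul_eq_mul]
  rw [ENNReal.ofReal_toReal hmt, Function.iterate_succ_apply']
  calc _ ≤ k * ∫⁻ z, g z ∂Leb := by gcongr; exact min_le_left _ _
    _ = q * ((K * ∫⁻ z, g z ∂Leb) / s.card) := by
        rw [hk, ENNReal.div_eq_inv_mul, ENNReal.div_eq_inv_mul]; ring
    _ ≤ q * ∫⁻ z in Metric.ball (f^[i] x₀) r, (lavg p)^[n] g z ∂Leb := by
        gcongr
        rw [ENNReal.div_le_iff' hcard hcard']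
        exact h1
    _ ≤ _ := mul_setLIntegral_le_lavg hy
        (ball_subset_ball_of_dist hi (by rwa [dist_self])) _

end transitive

/-! ### Positivity of the volume and absolute continuity -/

theorem IsVolumeMeasure.isOpenPosMeasure {d : ℕ} {M : Type*} [TopologicalSpace M]
    [MeasurableSpace M] [BorelSpace M] [ChartedSpace (EuclideanSpace ℝ (Fin d)) M] {m : Measure M}
    (hm : IsVolumeMeasure (d := d) m) : m.IsOpenPosMeasure := by
  refine ⟨fun U hU ⟨x, hx⟩ h0 => ?_⟩
  obtain ⟨ρ, hρ, hρ0, hmap⟩ := hm x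
  set e := chartAt (EuclideanSpace ℝ (Fin d)) x
  set W := e.target ∩ e.symm ⁻¹' U
  have hW : IsOpen W := e.isOpen_inter_preimage_symm hU
  have hWx : e x ∈ W :=
    ⟨e.map_source (mem_chart_source _ x), by
      rw [mem_preimage, e.left_inv (mem_chart_source _ x)]; exact hx⟩
  have he : AEMeasurable e (m.restrict e.source) :=
    e.continuousOn.aemeasurable e.open_source.measurableSet
  have h1 : (m.restrict e.source).map e W = 0 := by
    rw [Measure.map_apply_of_aemeasurable he hW.measurableSet,
      Measure.restrict_apply' e.open_source.measurableSet]
    refine measure_mono_null (fun y hy => ?_) h0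
    have := hy.1.2
    rwa [mem_preimage, e.left_inv hy.2] at this
  have hρm : AEMeasurable (fun y => ENNReal.ofReal (ρ y)) (volume.restrict e.target) :=
    (hρ.aemeasurable e.open_target.measurableSet).ennreal_ofReal
  rw [hmap, withDensity_apply_eq_zero' hρm, Measure.restrict_apply' e.open_target.measurableSet] at h1
  refine hW.measure_ne_zero volume ⟨_, hWx⟩ (measure_mono_null (fun y hy => ?_) h1)
  exact ⟨⟨(ENNReal.ofReal_pos.2 (hρ0 y hy.1)).ne', hy⟩, hy.1⟩

theorem absolutelyContinuous_of_invariant {M : Type*} [MeasurableSpace M] {p : Kernel M M}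
    {μ m : Measure M} (hμ : p.Invariant μ) (h : ∀ᵐ x ∂μ, p x ≪ m) : μ ≪ m := by
  refine Measure.AbsolutelyContinuous.mk fun A hA h0 => ?_
  rw [← hμ.def, Measure.bind_apply hA p.aemeasurable, lintegral_eq_zero_iff (p.measurable_coe hA)]
  exact h.mono fun x hx => hx h0

/-! ### Random maps -/

section random

variable {M X : Type*} [MeasurableSpace M] [MeasurableSpace X] {F : M → X → M}
  {θ : Measure X} [IsProbabilityMeasure θ]

theorem measurable_map_apply (hF : Measurable (Function.uncurry F)) :
    Measurable fun x => θ.map (F x) := by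
  refine Measure.measurable_of_measurable_coe _ fun A hA => ?_
  have : ∀ x, θ.map (F x) A = θ (Prod.mk x ⁻¹' (Function.uncurry F ⁻¹' A)) := fun x =>
    Measure.map_apply hF.of_uncurry_left hA
  simp only [this]
  exact measurable_measure_prodMk_left (hF hA)

/-- The transition kernel of the random maps. -/
noncomputable def randomKernel (θ : Measure X) [IsProbabilityMeasure θ] (hF : Measurable (Function.uncurry F)) :
    Kernel M M :=
  ⟨fun x => θ.map (F x), measurable_map_apply (θ := θ) hF⟩

theorem randomKernel_apply (hF : Measurable (Function.uncurry F)) (x : M) :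
    randomKernel θ hF x = θ.map (F x) := rfl

instance (hF : Measurable (Function.uncurry F)) : IsMarkovKernel (randomKernel θ hF) :=
  ⟨fun _ => Measure.isProbabilityMeasure_map hF.of_uncurry_left.aemeasurable⟩

/-- Stationarity tested on indicators, with the order of integration exchanged by Fubini. -/
theorem IsStationary.invariant {μ : Measure M} [IsProbabilityMeasure μ]
    (hF : Measurable (Function.uncurry F)) (hμ : IsStationary F θ μ) :
    (randomKernel θ hF).Invariant μ := by
  ext A hA
  have hB := hF hA
  rw [Measure.bind_apply hA (Kernel.aemeasurable _)]
  have h1 : ∀ x, randomKernel θ hF x A = θ (Prod.mk x ⁻¹' (Function.uncurry F ⁻¹' A)) := fun x =>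
    Measure.map_apply hF.of_uncurry_left hA
  simp only [h1]
  rw [← Measure.prod_apply hB, Measure.prod_apply_symm hB]
  have h2 := hμ (A.indicator 1) ((integrable_const (1 : ℝ)).indicator hA)
  rw [integral_indicator_one hA] at h2
  have h3 : ∀ ω, ∫ x, A.indicator (1 : M → ℝ) (F x ω) ∂μ =
      (μ ((fun x => (x, ω)) ⁻¹' (Function.uncurry F ⁻¹' A))).toReal := fun ω =>
    integral_indicator_one (hF.of_uncurry_right hA)
  simp only [h3] at h2
  rw [integral_toReal (measurable_measure_prodMk_right hB).aemeasurable
    (ae_of_all _ fun _ => measure_lt_top _ _)] at h2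
  refine (ENNReal.toReal_eq_toReal_iff' ?_ (measure_ne_top _ _)).1 h2
  rw [← Measure.prod_apply_symm hB]
  exact measure_ne_top _ _

theorem measurable_randomOrbit (hF : Measurable (Function.uncurry F)) (n : ℕ) :
    Measurable fun z : M × (ℕ → X) => randomOrbit F z.1 z.2 n := by
  induction n with
  | zero => exact measurable_fst
  | succ n ih =>
    exact hF.comp (ih.prodMk ((measurable_pi_apply n).comp measurable_snd))

theorem randomOrbit_congr (x : M) {ω ω' : ℕ → X} {n : ℕ} (h : ∀ i < n, ω i = ω' i) :
    randomOrbit F x ω n = randomOrbit F x ω' n := by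
  induction n with
  | zero => rfl
  | succ n ih =>
    rw [randomOrbit, randomOrbit, ih fun i hi => h i (by omega), h n (by omega)]

/-- The orbit up to time `n` uses only the letters `ω 0, …, ω (n - 1)`; arbitrary later letters are
filled in to write it as a function of these. -/
theorem indepFun_randomOrbit [Nonempty X] (hF : Measurable (Function.uncurry F)) (x : M) (n : ℕ) :
    IndepFun (fun (ω : ℕ → X) (i : Fin (n + 1)) => randomOrbit F x ω i) (fun ω => ω n)
      (Measure.infinitePi fun _ : ℕ => θ) := by
  classical
  have hind : iIndepFun (fun (i : ℕ) (ω : ℕ → X) => ω i) (Measure.infinitePi fun _ : ℕ => θ) :=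
    iIndepFun_infinitePi (X := fun _ x => x) fun _ => measurable_id
  have h := hind.indepFun_finset (Finset.range n) {n} (by simp) fun i => measurable_pi_apply i
  let ext : (Finset.range n → X) → ℕ → X := fun v i =>
    if hi : i ∈ Finset.range n then v ⟨i, hi⟩ else Classical.arbitrary X
  have hext : Measurable ext := measurable_pi_lambda _ fun i => by
    by_cases hi : i ∈ Finset.range n
    · simp only [ext, hi, dite_true]
      exact measurable_pi_apply _
    · simp only [ext, hi, dite_false]
      exact measurable_const
  have hψ : Measurable fun w : ({n} : Finset ℕ) → X => w ⟨n, Finset.mem_singleton_self n⟩ :=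
    measurable_pi_apply _
  have h2 := h.comp (φ := fun v (i : Fin (n + 1)) => randomOrbit F x (ext v) i)
    (ψ := fun w : ({n} : Finset ℕ) → X => w ⟨n, Finset.mem_singleton_self n⟩)
    (measurable_pi_lambda _ fun i =>
      (measurable_randomOrbit hF i).comp (measurable_const.prodMk hext))
    hψ
  convert h2 using 1
  · ext ω i
    refine randomOrbit_congr x fun j hj => ?_
    have hjn : j < n := by omega
    simp [ext, hjn]
  · rfl

/-- Past and fresh letter have a product law, so Fubini integrates the letter out first and produces
the kernel. -/
theorem infinitePi_transition [Nonempty X] (hF : Measurable (Function.uncurry F)) (x : M) (n : ℕ)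
    {B : Set (Fin (n + 1) → M)} {A : Set M} (hB : MeasurableSet B) (hA : MeasurableSet A) :
    Measure.infinitePi (fun _ : ℕ => θ)
        {ω | (fun i : Fin (n + 1) => randomOrbit F x ω i) ∈ B ∧ randomOrbit F x ω (n + 1) ∈ A} =
      ∫⁻ ω in {ω | (fun i : Fin (n + 1) => randomOrbit F x ω i) ∈ B},
        randomKernel θ hF (randomOrbit F x ω n) A ∂(Measure.infinitePi fun _ : ℕ => θ) := by
  set ν := Measure.infinitePi fun _ : ℕ => θ with hν
  set T : (ℕ → X) → Fin (n + 1) → M := fun ω i => randomOrbit F x ω i with hT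
  have hTm : Measurable T := measurable_pi_lambda _ fun i =>
    (measurable_randomOrbit hF i).comp (measurable_const.prodMk measurable_id)
  have hlaw := (indepFun_iff_map_prod_eq_prod_map_map hTm.aemeasurable
    (measurable_pi_apply n).aemeasurable).1 (indepFun_randomOrbit (θ := θ) hF x n)
  rw [← hν, show ν.map (fun ω => ω n) = θ from Measure.infinitePi_map_eval _ n] at hlaw
  set D : Set ((Fin (n + 1) → M) × X) := {a | a.1 ∈ B ∧ F (a.1 (Fin.last n)) a.2 ∈ A} with hD
  have hG : Measurable fun a : (Fin (n + 1) → M) × X => F (a.1 (Fin.last n)) a.2 :=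
    Measurable.comp (f := fun a : (Fin (n + 1) → M) × X => (a.1 (Fin.last n), a.2)) hF
      (by fun_prop)
  have hDm : MeasurableSet D := (measurable_fst hB).inter (hG hA)
  have h1 : ν {ω | T ω ∈ B ∧ randomOrbit F x ω (n + 1) ∈ A} = (ν.map T).prod θ D := by
    rw [← hlaw, Measure.map_apply (hTm.prodMk (measurable_pi_apply n)) hDm]
    rfl
  have hprob : IsProbabilityMeasure (ν.map T) := Measure.isProbabilityMeasure_map hTm.aemeasurable
  have h2 : ∀ v, θ (Prod.mk v ⁻¹' D) =
      B.indicator (fun v => randomKernel θ hF (v (Fin.last n)) A) v := fun v => by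
    by_cases hv : v ∈ B
    · rw [indicator_of_mem hv, randomKernel_apply, Measure.map_apply hF.of_uncurry_left hA]
      congr 1
      ext w
      simp [hD, hv]
    · rw [indicator_of_notMem hv]
      convert measure_empty (μ := θ)
      ext w
      simp [hD, hv]
  rw [h1, Measure.prod_apply hDm]
  simp only [h2]
  have hk : Measurable fun v : Fin (n + 1) → M => randomKernel θ hF (v (Fin.last n)) A :=
    (Kernel.measurable_coe _ hA).comp (measurable_pi_apply _)
  rw [lintegral_indicator hB, setLIntegral_map hB hk hTm]
  rfl

theorem isMarkovChain_randomOrbit [Nonempty X] (hF : Measurable (Function.uncurry F))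
    (μ : Measure M) [IsProbabilityMeasure μ] :
    IsMarkovChain (annealedMeasure μ θ) (randomKernel θ hF) μ
      (fun n z => randomOrbit F z.1 z.2 n) where
  measurable := measurable_randomOrbit hF
  initial := by
    change (annealedMeasure μ θ).map Prod.fst = μ
    rw [annealedMeasure, Measure.map_fst_prod, measure_univ, one_smul]
  transition n B A hB hA := by
    have hpast : Measurable fun (z : M × (ℕ → X)) (i : Fin (n + 1)) => randomOrbit F z.1 z.2 i :=
      measurable_pi_lambda _ fun i => measurable_randomOrbit hF i
    have hk : Measurable fun z : M × (ℕ → X) => randomKernel θ hF (randomOrbit F z.1 z.2 n) A :=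
      (Kernel.measurable_coe _ hA).comp (measurable_randomOrbit hF n)
    have hS : MeasurableSet
        {z : M × (ℕ → X) | (fun i : Fin (n + 1) => randomOrbit F z.1 z.2 i) ∈ B} := hpast hB
    rw [annealedMeasure, ← lintegral_indicator hS, lintegral_prod _ (hk.indicator hS).aemeasurable]
    refine (Measure.prod_apply (hS.inter (measurable_randomOrbit hF (n + 1) hA))).trans ?_
    refine lintegral_congr fun x => ?_
    refine (infinitePi_transition (θ := θ) hF x n hB hA).trans ?_
    exact (lintegral_indicator (measurable_prodMk_left hS) _).symm

theorem IsUniformRandomPerturbation.exists_isMixingChain {M X : Type*} [MetricSpace M]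
    [CompactSpace M] [ConnectedSpace M] [MeasurableSpace M] [BorelSpace M] [MetricSpace X]
    [MeasurableSpace X] {Leb : Measure M} [Leb.IsOpenPosMeasure] {f : M → M} {Y : Set M} {x₀ : M}
    (hf : IsTransitiveOn Leb f Y x₀) {F : M → X → M} {θ : Measure X} [IsProbabilityMeasure θ]
    {ωstar : X} (h : IsUniformRandomPerturbation Leb f F θ ωstar) {μ : Measure M}
    [IsProbabilityMeasure μ] (hac : ∀ᵐ x ∂μ, θ.map (F x) ≪ Leb) (hμ : IsStationary F θ μ) :
    ∃ (N : ℕ) (c C : ℝ), IsMixingChain (annealedMeasure μ θ) (randomKernel θ h.measurable) μ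
      (fun n z => randomOrbit F z.1 z.2 n) N c C := by
  have : Nonempty X := ⟨ωstar⟩
  obtain ⟨ρ, hρ, hcov⟩ := h.covers
  obtain ⟨qlo, qhi, hlo, hlohi, hdens⟩ := h.density
  have hlow : ∀ᵐ x ∂Leb, ENNReal.ofReal qlo • Leb.restrict (Metric.ball (f x) ρ) ≤
      randomKernel θ h.measurable x := by
    filter_upwards [hcov, hdens] with x hx ⟨q, hq, hqx, hqb⟩
    refine Measure.le_iff.2 fun A hA => ?_
    rw [randomKernel_apply, Measure.smul_apply, smul_eq_mul, Measure.restrict_apply hA, hqx,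
      withDensity_apply _ hA, ← setLIntegral_const]
    calc _ ≤ ∫⁻ y in A ∩ Metric.ball (f x) ρ, q y ∂Leb := by
          refine lintegral_mono_ae
            ((ae_restrict_iff' (hA.inter Metric.isOpen_ball.measurableSet)).2 ?_)
          filter_upwards [hqb] with y hy hyA
          rw [ENNReal.ofReal_le_iff_le_toReal ENNReal.coe_ne_top]
          exact (hy (hx hyA.2)).1
      _ ≤ _ := lintegral_mono_set inter_subset_left
  have hup : ∀ A, MeasurableSet A →
      ∀ᵐ x ∂Leb, randomKernel θ h.measurable x A ≤ ENNReal.ofReal qhi * Leb A := fun A hA => by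
    -- The density is bounded above only on the support, but the complement of the support carries
    -- no mass.
    filter_upwards [hdens] with x ⟨q, hq, hqx, hqb⟩
    set S := (θ.map (F x)).support with hS
    have hSm : MeasurableSet S := Measure.isClosed_support.measurableSet
    rw [randomKernel_apply]
    calc θ.map (F x) A = θ.map (F x) (A ∩ S) := by
          rw [measure_inter_conull Measure.measure_compl_support]
      _ = ∫⁻ y in A ∩ S, q y ∂Leb := by
          conv_lhs => rw [hqx, withDensity_apply _ (hA.inter hSm)]
      _ ≤ ∫⁻ _ in A ∩ S, ENNReal.ofReal qhi ∂Leb := by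
          refine lintegral_mono_ae ((ae_restrict_iff' (hA.inter hSm)).2 ?_)
          filter_upwards [hqb] with y hy hyA
          rw [ENNReal.le_ofReal_iff_toReal_le ENNReal.coe_ne_top (by linarith)]
          exact (hy hyA.2).2
      _ ≤ _ := by
          rw [setLIntegral_const]
          gcongr
          exact inter_subset_left
  obtain ⟨N, c, hN, hc, hD⟩ := hf.exists_lower_bound hρ (ENNReal.ofReal_pos.2 hlo).ne' hlow
  have hinv := hμ.invariant h.measurable
  exact ⟨N, (isMarkovChain_randomOrbit h.measurable μ).exists_isMixingChain hinv
    (absolutelyContinuous_of_invariant hinv hac) hN (by linarith) hc hup hD⟩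

end random

/-- For `x ∈ Y` the bounds on `q x` hold on all of `M`, so a single step already dominates `qlo •
Leb`. -/
theorem IsMarkovPerturbation.exists_isMixingChain {M Ω : Type*} [MetricSpace M] [MeasurableSpace M]
    [MeasurableSpace Ω] {Leb : Measure M} {f : M → M} {Y : Set M} (hY : ∀ᵐ x ∂Leb, x ∈ Y)
    {p : Kernel M M} [IsMarkovKernel p] (h : IsMarkovPerturbation Leb f Y p) {μ : Measure M}
    [IsProbabilityMeasure μ] (hμ : p.Invariant μ) {P : Measure Ω} [IsProbabilityMeasure P]
    {Z : ℕ → Ω → M} (hZ : IsMarkovChain P p μ Z) :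
    ∃ (N : ℕ) (c C : ℝ), IsMixingChain P p μ Z N c C := by
  obtain ⟨q, -, hpq, -, -, qlo, qhi, hlo, hlohi, hb⟩ := h.density
  have hac : μ ≪ Leb := absolutelyContinuous_of_invariant hμ
    (ae_of_all _ fun x => hpq x ▸ withDensity_absolutelyContinuous _ _)
  refine ⟨1, hZ.exists_isMixingChain hμ hac one_pos (D := qhi) (c := qlo) (by linarith) hlo
    (fun A hA => ?_) fun g _ => ?_⟩
  · filter_upwards [hY] with x hx
    rw [hpq, withDensity_apply _ hA, ← setLIntegral_const]
    exact lintegral_mono fun y => ENNReal.ofReal_le_ofReal (hb x hx y).2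
  · filter_upwards [hY] with x hx
    have hle : ENNReal.ofReal qlo • Leb ≤ p x := by
      rw [hpq, ← withDensity_const]
      exact withDensity_mono (ae_of_all _ fun y => ENNReal.ofReal_le_ofReal (hb x hx y).1)
    rw [← smul_eq_mul, ← lintegral_smul_measure]
    exact lintegral_mono' hle le_rfl

end RareEvents

/-! ### The two settings of the theorem -/

theorem corollaryE {d : ℕ} {M : Type a} [MetricSpace M] [CompactSpace M]
    [ConnectedSpace M]
    [ChartedSpace (EuclideanSpace ℝ (Fin d)) M] [IsManifold (𝓡 d) (⊤ : ℕ∞) M]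
    [Bundle.RiemannianBundle (fun x : M => TangentSpace (𝓡 d) x)]
    [IsContMDiffRiemannianBundle (𝓡 d) (⊤ : ℕ∞) (EuclideanSpace ℝ (Fin d))
      (fun x : M => TangentSpace (𝓡 d) x)]
    [IsRiemannianManifold (𝓡 d) M]
    [MeasurableSpace M] [BorelSpace M]
    (Leb : Measure M) [IsProbabilityMeasure Leb] (hLeb : IsVolumeMeasure (d := d) Leb)
    (f : M → M) (Y : Set M) (x₀ : M) (hf : IsTransitiveOn Leb f Y x₀)
    (μ : Measure M) [IsProbabilityMeasure μ]
    (φ : M → EReal) (ζ : M) (hφ : IsRegularObservable d μ φ ζ)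
    (u : ℕ → ℝ) (τ : ℝ) (hτ : 0 < τ)
    (hu : Tendsto (fun n : ℕ => (n : ℝ) * μ.real {x | (u n : EReal) < φ x}) atTop (𝓝 τ)) :
    (∀ (X : Type b) [MetricSpace X] [CompactSpace X] [MeasurableSpace X] [BorelSpace X]
      (θ : Measure X) [IsProbabilityMeasure θ] (ωstar : X) (F : M → X → M),
      IsUniformRandomPerturbation Leb f F θ ωstar →
      (∀ᵐ x ∂μ, θ.map (F x) ≪ Leb) →
      IsStationary F θ μ →
      HasPoissonRareEvents.{v} (annealedMeasure μ θ)
        (fun n (z : M × (ℕ → X)) => φ (randomOrbit F z.1 z.2 n)) u) ∧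
    (∀ (p : Kernel M M) [IsMarkovKernel p],
      IsMarkovPerturbation Leb f Y p →
      p.Invariant μ →
      ∀ (Ω : Type c) [MeasurableSpace Ω] (P : Measure Ω) [IsProbabilityMeasure P]
        (Z : ℕ → Ω → M), IsMarkovChain P p μ Z →
        HasPoissonRareEvents.{v} P (fun n ω => φ (Z n ω)) u) := by
  have := hLeb.isOpenPosMeasure
  refine ⟨fun X _ _ _ _ θ _ ωstar F hF hac hstat => ?_, fun p _ hp hinv Ω _ P _ Z hZ => ?_⟩
  · obtain ⟨N, c, C, h⟩ := hF.exists_isMixingChain hf hac hstat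
    exact h.hasPoissonRareEvents hφ.measurable hτ hu
  · obtain ⟨N, c, C, h⟩ := hp.exists_isMixingChain hf.full hinv hZ
    exact h.hasPoissonRareEvents hφ.measurable hτ hu
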